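/- **Definitions.** A graphon $(W,S,\mathcal F,\mu)$ is a symmetric integrable function $W:S\times S\to\mathbb R$, where $(S,\mathcal F,\mu)$ is a $\sigma$-finite measure space (integrability is with respect to $\mu\times\mu$; $W$ need be neither bounded nor non-negative). A map $\varphi:(S_1,\mathcal F_1,\mu_1)\to(S_2,\mathcal F_2,\mu_2)$ is measure-preserving if it is measurable and $\mu_1(\varphi^{-1}(A))=\mu_2(A)$ for all $A\in\mathcal F_2$; the pull-back of $W:S_2^2\to\mathbb R$ is $W^{\varphi}(x,y)=W(\varphi(x),\varphi(y))$. A graphon $(\widetilde W,\widetilde S,\widetilde\mu)$ is a trivial extension of $(W,S,\mu)$ if $(S,\mu)$ is (up to isomorphism of measure spaces) a measurable subset of $\widetilde S$ with the restricted $\sigma$-algebra and measure, $\widetilde W=W$ on $S\times S$, and $\widetilde W=0$ off $S\times S$. A coupling of $S_1$ and $S_2$ is a pair of measure-preserving maps $\varphi_i:S\to S_i$ $(i=1,2)$ from a common $\sigma$-finite measure space $(S,\mathcal F,\mu)$. The cut norm of $F\in L^1(S\times S,\mu\times\mu)$ is $$\|F\|_\square=\sup_{T,U}\Bigl|\int_{T\times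 U}F\,d(\mu\times\mu)\Bigr|,$$ over all measurable $T,U\subseteq S$. For graphons $(W_i,S_i,\mu_i)$, $i=1,2$, with $\mu_1(S_1)=\mu_2(S_2)$, put $$\delta_\square(W_1,W_2)=\inf_{(\varphi_1,\varphi_2)}\|W_1^{\varphi_1}-W_2^{\varphi_2}\|_\square,\qquad \delta_1(W_1,W_2)=\inf_{(\varphi_1,\varphi_2)}\|W_1^{\varphi_1}-W_2^{\varphi_2}\|_{L^1},$$ the infima being over all couplings of $S_1$ and $S_2$. If $\mu_1(S_1)\ne\mu_2(S_2)$, put $\delta(W_1,W_2)=\delta(\widetilde W_1,\widetilde W_2)$ for $\delta=\delta_\square$ and $\delta=\delta_1$, where $\widetilde W_1,\widetilde W_2$ are trivial extensions of $W_1,W_2$ to spaces of equal total measure; as the value does not depend on the extensions, one may take the infimum over all such pairs. Two graphons are equivalent, $W_1\cong W_2$, if $\delta_\square(W_1,W_2)=0$. They are elementarily equivalent if one of them is a.e. equal to the pull-back of the other by a measure-preserving map, or one of them is a trivial extension of the other. **Theorem 5.5.** Let $W$ and $W'$ be two graphons. Then the following are equivalent: 1. $W\cong W'$; 2. $\delta_\square(W,W')=0$;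 3. $\delta_1(W,W')=0$; 4. there exists a finite sequence of graphons $W=W_0,W_1,\dots,W_N=W'$ such that $W_{i-1}$ and $W_i$ are elementarily equivalent for $i=1,\dots,N$. -/

import Mathlib

open MeasureTheory
open scoped ENNReal

universe u

/-- A graphon `(W, S, ℱ, μ)`: a symmetric integrable function `W : S × S → ℝ` on a σ-finite measure
space. It need be neither bounded nor non-negative. -/
structure Graphon : Type (u + 1) where
  /-- the underlying set `S` -/
  S : Type u
  /-- the σ-algebra `ℱ` -/
  [measurableSpace : MeasurableSpace S]
  /-- the measure `μ` -/
  μ : Measure S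
  [sigmaFinite : SigmaFinite μ]
  /-- the function `W` -/
  W : S → S → ℝ
  symm : ∀ x y, W x y = W y x
  integrable : Integrable (fun p : S × S => W p.1 p.2) (μ.prod μ)

attribute [instance] Graphon.measurableSpace Graphon.sigmaFinite

/-- The cut norm `sup_{T,U} |∫_{T×U} F d(μ×μ)|`, over all measurable `T, U ⊆ S`. -/
noncomputable def cutNorm {S : Type u} [MeasurableSpace S] (μ : Measure S) (F : S → S → ℝ) :
    ℝ≥0∞ :=
  ⨆ (T : Set S) (U : Set S) (_ : MeasurableSet T) (_ : MeasurableSet U),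
    ‖∫ p in T ×ˢ U, F p.1 p.2 ∂(μ.prod μ)‖ₑ

/-- The `L¹` norm of `F` on `(S × S, μ × μ)`. -/
noncomputable def normLOne {S : Type u} [MeasurableSpace S] (μ : Measure S) (F : S → S → ℝ) :
    ℝ≥0∞ :=
  eLpNorm (fun p : S × S => F p.1 p.2) 1 (μ.prod μ)

/-- A coupling of two measure spaces: a pair of measure-preserving maps to them from a common
σ-finite measure space. -/
structure Coupling {S₁ S₂ : Type u} [MeasurableSpace S₁] [MeasurableSpace S₂]
    (μ₁ : Measure S₁) (μ₂ : Measure S₂) : Type (u + 1) where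
  S : Type u
  [measurableSpace : MeasurableSpace S]
  μ : Measure S
  [sigmaFinite : SigmaFinite μ]
  φ₁ : S → S₁
  φ₂ : S → S₂
  measurePreserving₁ : MeasurePreserving φ₁ μ μ₁
  measurePreserving₂ : MeasurePreserving φ₂ μ μ₂

attribute [instance] Coupling.measurableSpace Coupling.sigmaFinite

namespace Graphon

/-- The pull-back `W^φ(x, y) = W(φ(x), φ(y))`. -/
def pullback {T : Type u} (G : Graphon.{u}) (φ : T → G.S) : T → T → ℝ :=
  fun x y => G.W (φ x) (φ y)

/-- `H` is a trivial extension of `G`: the measure space of `G` is (identified by `ι` with) a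
subspace of that of `H`, i.e. a measurable subset with the trace σ-algebra and the restricted
measure, and the function of `H` extends that of `G` by `0`. -/
def IsTrivialExtension (H G : Graphon.{u}) : Prop :=
  ∃ ι : G.S → H.S, MeasurableEmbedding ι ∧ H.μ.comap ι = G.μ ∧
    (∀ x y, H.W (ι x) (ι y) = G.W x y) ∧
    ∀ x y, ¬ (x ∈ Set.range ι ∧ y ∈ Set.range ι) → H.W x y = 0

/-- `inf ‖W₁^{φ₁} - W₂^{φ₂}‖_□` over all couplings `(φ₁, φ₂)`; it is `∞` if there are none. -/
noncomputable def cutDistEqualMass (G₁ G₂ : Graphon.{u}) : ℝ≥0∞ :=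
  ⨅ c : Coupling G₁.μ G₂.μ,
    cutNorm c.μ (fun x y => G₁.pullback c.φ₁ x y - G₂.pullback c.φ₂ x y)

/-- `inf ‖W₁^{φ₁} - W₂^{φ₂}‖_{L¹}` over all couplings `(φ₁, φ₂)`; it is `∞` if there are none. -/
noncomputable def distLOneEqualMass (G₁ G₂ : Graphon.{u}) : ℝ≥0∞ :=
  ⨅ c : Coupling G₁.μ G₂.μ,
    normLOne c.μ (fun x y => G₁.pullback c.φ₁ x y - G₂.pullback c.φ₂ x y)

open Classical in
/-- The two-step definition common to the invariant distances: if the two total masses agree, take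
`d`; otherwise pass to trivial extensions with equal total masses. The value does not depend on
the extensions for the two distances below; the infimum over them avoids a choice. -/
noncomputable def extendDist (d : Graphon.{u} → Graphon.{u} → ℝ≥0∞) (G₁ G₂ : Graphon.{u}) :
    ℝ≥0∞ :=
  if G₁.μ Set.univ = G₂.μ Set.univ then d G₁ G₂
  else
    ⨅ (H₁ : Graphon.{u}) (H₂ : Graphon.{u}) (_ : H₁.IsTrivialExtension G₁)
      (_ : H₂.IsTrivialExtension G₂) (_ : H₁.μ Set.univ = H₂.μ Set.univ), d H₁ H₂

/-- The cut metric `δ_□`. -/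
noncomputable def cutDist : Graphon.{u} → Graphon.{u} → ℝ≥0∞ :=
  extendDist cutDistEqualMass

/-- The invariant `L¹` metric `δ₁`. -/
noncomputable def distLOne : Graphon.{u} → Graphon.{u} → ℝ≥0∞ :=
  extendDist distLOneEqualMass

/-- Equivalence of graphons, `G₁ ≅ G₂`. -/
def Equivalent (G₁ G₂ : Graphon.{u}) : Prop :=
  cutDist G₁ G₂ = 0

/-- `W₁ = W₂^φ` a.e. for some measure-preserving `φ : S₁ → S₂`. -/
def IsPullback (G₁ G₂ : Graphon.{u}) : Prop :=
  ∃ φ : G₁.S → G₂.S, MeasurePreserving φ G₁.μ G₂.μ ∧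
    ∀ᵐ p ∂(G₁.μ.prod G₁.μ), G₁.W p.1 p.2 = G₂.pullback φ p.1 p.2

/-- Elementary equivalence: one graphon is a.e. a measure-preserving pull-back of the other, or one
is a trivial extension of the other. -/
def ElementarilyEquivalent (G₁ G₂ : Graphon.{u}) : Prop :=
  (G₁.IsPullback G₂ ∨ G₂.IsPullback G₁) ∨
    (G₁.IsTrivialExtension G₂ ∨ G₂.IsTrivialExtension G₁)

end Graphon

/-! The cut norm is at most the `L¹` norm, so `δ₁ = 0` gives `δ_□ = 0`. The work lies in passing
from a chain to `δ₁ = 0` and from `δ_□ = 0` to a chain.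

From a chain to `δ₁ = 0`. On general σ-finite spaces couplings need not glue along a common factor,
since disintegrations may fail to exist. An approximate gluing suffices: an integrable kernel is
`L¹`-close to a step kernel with countably many cells of finite mass, and two spaces that give the
same masses to corresponding cells can be coupled cell by cell. This makes distance `0` transitive
(`Graphon.distLOneEqualMass_le_normLOne_add`) and lets trivial extensions be stripped off
(`exists_coupling_normLOne_le`, `Graphon.distLOneEqualMass_eq_zero_of_isTrivialExtension`). Since
the total masses may change along a chain, infinitely many unit atoms are first adjoined to every
graphon (`Graphon.stabilize`) and removed at the end.

From `δ_□ = 0` to a chain. Every graphon is a.e. a pull-back of a kernel `V` on the Cantor space, by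
the code of countably many sets of finite measure that cover it (`Graphon.exists_cantorKernel`); the
origin is kept free for the points that a trivial extension adds. Couplings of small cut norm push
forward to measures on the square of the Cantor space with prescribed marginals off the origin.
Their masses on a clopen set that avoids the origin of the square are bounded, so they converge
along an ultrafilter on such sets. The kernels `V₁` and `V₂` need not be continuous, but each sees
only one, fixed, marginal, so its integrals over clopen rectangles still converge. In the limit the
two kernels have the same integrals over these rectangles, hence agree a.e.
(`IsPartialCoupling.exists_ae_eq`). The limit measure joins the two graphons by pull-backs and
trivial extensions (`Graphon.reflTransGen_of_cutDist_eq_zero`). -/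

/-! ### Couplings from matrices of cell masses -/

section MatrixCoupling

variable {A B : Type*} [MeasurableSpace A] [MeasurableSpace B]

/-- On cell `i` the integral is `∑ j, m i j / (α_i β_j) * β_j = (∑ j, m i j) / α_i`. This is what
makes the first marginal of the density in `exists_coupling_of_matrix` equal to `α`. -/
theorem lintegral_matrixDensity_eq_one {α : Measure A} {β : Measure B}
    {k : A → ℕ} {l : B → ℕ} (hl : Measurable l) {m : ℕ → ℕ → ℝ≥0∞}
    (hrow : ∀ i, ∑' j, m i j = α (k ⁻¹' {i})) (hcol : ∀ j, ∑' i, m i j = β (l ⁻¹' {j}))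
    (hα : ∀ i, α (k ⁻¹' {i}) ≠ ∞) (hβ : ∀ j, β (l ⁻¹' {j}) ≠ ∞) :
    ∀ᵐ a ∂α, ∫⁻ b, m (k a) (l b) / (α (k ⁻¹' {k a}) * β (l ⁻¹' {l b})) ∂β = 1 := by
  have h0 : ∀ᵐ a ∂α, α (k ⁻¹' {k a}) ≠ 0 := by
    rw [ae_iff]
    have : {a | ¬ α (k ⁻¹' {k a}) ≠ 0} ⊆ ⋃ i : {i : ℕ // α (k ⁻¹' {i}) = 0}, k ⁻¹' {i.1} := by
      intro a ha
      simp only [ne_eq, not_not, Set.mem_ofPred_eq] at ha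
      exact Set.mem_iUnion.2 ⟨⟨k a, ha⟩, rfl⟩
    exact measure_mono_null this (measure_iUnion_null fun i => i.2)
  filter_upwards [h0] with a ha
  set i := k a
  have hmap : ∫⁻ b, m i (l b) / (α (k ⁻¹' {i}) * β (l ⁻¹' {l b})) ∂β
      = ∫⁻ j, m i j / (α (k ⁻¹' {i}) * β (l ⁻¹' {j})) ∂(β.map l) := by
    rw [lintegral_map (measurable_of_countable _) hl]
  rw [hmap, lintegral_countable']
  have hterm : ∀ j, m i j / (α (k ⁻¹' {i}) * β (l ⁻¹' {j})) * (β.map l) {j}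
      = m i j * (α (k ⁻¹' {i}))⁻¹ := by
    intro j
    rw [Measure.map_apply hl (measurableSet_singleton j)]
    -- A null cell forces its whole column to vanish, so no cancellation of `β_j` is needed there.
    by_cases hb : β (l ⁻¹' {j}) = 0
    · have : m i j = 0 := by
        have := hcol j
        rw [hb, ENNReal.tsum_eq_zero] at this
        exact this i
      simp [this]
    · rw [div_eq_mul_inv, ENNReal.mul_inv (Or.inl ha) (Or.inl (hα i)), mul_assoc, mul_assoc,
        ENNReal.inv_mul_cancel hb (hβ j), mul_one]
  simp_rw [hterm]
  rw [ENNReal.tsum_mul_right, hrow, ENNReal.mul_inv_cancel ha (hα i)]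

/-- A matrix whose row and column sums are the masses of the cells of two countable partitions
lifts to a coupling that lives on the pairs of cells with a nonzero entry. -/
theorem exists_coupling_of_matrix (α : Measure A) (β : Measure B) [SigmaFinite α] [SigmaFinite β]
    {k : A → ℕ} {l : B → ℕ} (hk : Measurable k) (hl : Measurable l) (m : ℕ → ℕ → ℝ≥0∞)
    (hrow : ∀ i, ∑' j, m i j = α (k ⁻¹' {i})) (hcol : ∀ j, ∑' i, m i j = β (l ⁻¹' {j}))
    (hα : ∀ i, α (k ⁻¹' {i}) ≠ ∞) (hβ : ∀ j, β (l ⁻¹' {j}) ≠ ∞) :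
    ∃ γ : Measure (A × B), MeasurePreserving Prod.fst γ α ∧ MeasurePreserving Prod.snd γ β ∧
      ∀ᵐ p ∂γ, m (k p.1) (l p.2) ≠ 0 := by
  -- On each product of cells the coupling is a multiple of the product measure, scaled to have mass
  -- `m i j`.
  set D : A × B → ℝ≥0∞ := fun p => m (k p.1) (l p.2) / (α (k ⁻¹' {k p.1}) * β (l ⁻¹' {l p.2}))
    with hD
  have hDm : Measurable D := by
    have : D = (fun q : ℕ × ℕ => m q.1 q.2 / (α (k ⁻¹' {q.1}) * β (l ⁻¹' {q.2}))) ∘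
        (Prod.map k l) := rfl
    rw [this]
    exact (measurable_of_countable _).comp (hk.prodMap hl)
  refine ⟨(α.prod β).withDensity D, ⟨measurable_fst, ?_⟩, ⟨measurable_snd, ?_⟩, ?_⟩
  · ext E hE
    rw [Measure.map_apply measurable_fst hE, withDensity_apply _ (measurable_fst hE),
      ← Set.prod_univ, ← Measure.prod_restrict, Measure.restrict_univ,
      lintegral_prod _ hDm.aemeasurable]
    have := lintegral_matrixDensity_eq_one hl hrow hcol hα hβ
    rw [lintegral_congr_ae (ae_restrict_of_ae this)]
    simp
  · ext E hE
    rw [Measure.map_apply measurable_snd hE, withDensity_apply _ (measurable_snd hE),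
      ← Set.univ_prod, ← Measure.prod_restrict, Measure.restrict_univ,
      lintegral_prod_symm _ hDm.aemeasurable]
    -- The second marginal is the first marginal of the transposed matrix.
    have := lintegral_matrixDensity_eq_one (m := fun j i => m i j) hk hcol hrow hβ hα
    rw [lintegral_congr_ae (g := fun _ => 1)]
    · simp
    · filter_upwards [ae_restrict_of_ae this] with b hb
      rw [← hb]
      simp only [hD, mul_comm]
  · rw [ae_withDensity_iff hDm]
    refine Filter.Eventually.of_forall fun p hp h => hp ?_
    simp [hD, h]

end MatrixCoupling

/-! ### Couplings of spaces of equal mass, and along cells of equal mass -/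

section EqualMass

/-- The intervals of lengths `a 0, a 1, …` laid next to each other from `0`. -/
noncomputable def consecutiveInterval (a : ℕ → ℝ≥0∞) (i : ℕ) : Set ℝ :=
  Set.Ico (∑ r ∈ Finset.range i, (a r).toReal) (∑ r ∈ Finset.range (i + 1), (a r).toReal)

theorem monotone_sum_range_toReal (a : ℕ → ℝ≥0∞) :
    Monotone fun i => ∑ r ∈ Finset.range i, (a r).toReal :=
  monotone_nat_of_le_succ fun i => by
    rw [Finset.sum_range_succ]
    exact le_add_of_nonneg_right ENNReal.toReal_nonneg

theorem pairwise_disjoint_consecutiveInterval (a : ℕ → ℝ≥0∞) :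
    Pairwise (Function.onFun Disjoint (consecutiveInterval a)) :=
  (monotone_sum_range_toReal a).pairwise_disjoint_on_Ico_succ

theorem volume_consecutiveInterval {a : ℕ → ℝ≥0∞} (ha : ∀ i, a i ≠ ∞) (i : ℕ) :
    volume (consecutiveInterval a i) = a i := by
  rw [consecutiveInterval, Real.volume_Ico, Finset.sum_range_succ, add_sub_cancel_left,
    ENNReal.ofReal_toReal (ha i)]

/-- The intervals tile `[0, ∑ a i)`, which is the whole half-line when the sum is infinite. The tile
of `x` ends at the first partial sum beyond `x`. -/
theorem mem_iUnion_consecutiveInterval {a : ℕ → ℝ≥0∞} (ha : ∀ i, a i ≠ ∞) (x : ℝ) :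
    x ∈ ⋃ i, consecutiveInterval a i ↔ 0 ≤ x ∧ ENNReal.ofReal x < ∑' i, a i := by
  have hsum : ∀ n, ENNReal.ofReal (∑ r ∈ Finset.range n, (a r).toReal)
      = ∑ r ∈ Finset.range n, a r := by
    intro n
    rw [ENNReal.ofReal_sum_of_nonneg fun _ _ => ENNReal.toReal_nonneg]
    exact Finset.sum_congr rfl fun r _ => ENNReal.ofReal_toReal (ha r)
  rw [Set.mem_iUnion]
  constructor
  · rintro ⟨i, h1, h2⟩
    have h0 : 0 ≤ x := le_trans (Finset.sum_nonneg fun _ _ => ENNReal.toReal_nonneg) h1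
    refine ⟨h0, lt_of_lt_of_le ?_ (ENNReal.sum_le_tsum (Finset.range (i + 1)))⟩
    rw [← hsum]
    exact (ENNReal.ofReal_lt_ofReal_iff_of_nonneg h0).2 h2
  · rintro ⟨h0, h⟩
    rw [ENNReal.tsum_eq_iSup_nat, lt_iSup_iff] at h
    have hex : ∃ n, x < ∑ r ∈ Finset.range n, (a r).toReal := by
      obtain ⟨n, hn⟩ := h
      refine ⟨n, ?_⟩
      rw [← hsum] at hn
      exact (ENNReal.ofReal_lt_ofReal_iff_of_nonneg h0).1 hn
    classical
    have hspec := Nat.find_spec hex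
    have hmin := fun m => Nat.find_min hex (m := m)
    rcases hn : Nat.find hex with _ | n
    · rw [hn] at hspec
      simp at hspec
      linarith
    · refine ⟨n, ?_, by rw [hn] at hspec; exact hspec⟩
      exact not_lt.1 (hmin n (by omega))

/-- Two sequences with the same sum tile the same interval, so the tiles of one cut each tile of the
other without loss. The lengths of the overlaps form a matrix with prescribed row and column sums,
even when the sum is infinite. -/
theorem tsum_volume_inter_consecutiveInterval {a b : ℕ → ℝ≥0∞} (ha : ∀ i, a i ≠ ∞)
    (hb : ∀ i, b i ≠ ∞) (h : ∑' i, a i = ∑' i, b i) (i : ℕ) :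
    ∑' j, volume (consecutiveInterval a i ∩ consecutiveInterval b j) = a i := by
  rw [← measure_iUnion, ← Set.inter_iUnion, ← volume_consecutiveInterval ha i]
  · congr 1
    refine Set.inter_eq_left.2 fun x hx => ?_
    rw [mem_iUnion_consecutiveInterval hb, ← h, ← mem_iUnion_consecutiveInterval ha]
    exact Set.mem_iUnion.2 ⟨i, hx⟩
  · intro j j' hjj
    exact (pairwise_disjoint_consecutiveInterval b hjj).mono Set.inter_subset_right
      Set.inter_subset_right
  · exact fun j => measurableSet_Ico.inter measurableSet_Ico

variable {A B : Type*} [MeasurableSpace A] [MeasurableSpace B]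

theorem measure_preimage_spanningSetsIndex_ne_top (α : Measure A) [SigmaFinite α] (i : ℕ) :
    α (spanningSetsIndex α ⁻¹' {i}) ≠ ∞ := by
  rw [preimage_spanningSetsIndex_singleton]
  exact ((measure_mono (disjointed_subset _ _)).trans_lt (measure_spanningSets_lt_top α i)).ne

theorem tsum_measure_preimage_singleton_nat (α : Measure A) {k : A → ℕ} (hk : Measurable k) :
    ∑' i, α (k ⁻¹' {i}) = α Set.univ := by
  rw [← measure_iUnion, ← Set.preimage_iUnion, Set.iUnion_of_singleton, Set.preimage_univ]
  · exact fun i j hij => Set.disjoint_left.2 fun x hx hx' => hij (hx.symm.trans hx')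
  · exact fun i => hk (measurableSet_singleton i)

/-- Any two σ-finite measures of equal total mass are coupled. -/
theorem exists_coupling_of_measure_univ_eq (α : Measure A) (β : Measure B) [SigmaFinite α]
    [SigmaFinite β] (h : α Set.univ = β Set.univ) :
    ∃ γ : Measure (A × B), MeasurePreserving Prod.fst γ α ∧ MeasurePreserving Prod.snd γ β := by
  have hk := measurableSet_spanningSetsIndex α
  have hl := measurableSet_spanningSetsIndex β
  have ha := measure_preimage_spanningSetsIndex_ne_top α
  have hb := measure_preimage_spanningSetsIndex_ne_top β
  have hab : ∑' i, α (spanningSetsIndex α ⁻¹' {i}) = ∑' i, β (spanningSetsIndex β ⁻¹' {i}) := by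
    rw [tsum_measure_preimage_singleton_nat α hk, tsum_measure_preimage_singleton_nat β hl, h]
  obtain ⟨γ, h1, h2, -⟩ := exists_coupling_of_matrix α β hk hl
    (fun i j => volume (consecutiveInterval (fun i => α (spanningSetsIndex α ⁻¹' {i})) i ∩
      consecutiveInterval (fun i => β (spanningSetsIndex β ⁻¹' {i})) j))
    (fun i => tsum_volume_inter_consecutiveInterval ha hb hab i)
    (fun j => by
      simp_rw [Set.inter_comm (consecutiveInterval (fun i => α (spanningSetsIndex α ⁻¹' {i})) _)]
      exact tsum_volume_inter_consecutiveInterval hb ha hab.symm j) ha hb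
  exact ⟨γ, h1, h2⟩

/-- Two σ-finite measures that give the same finite masses to the cells of two partitions are
coupled along the diagonal of these cells. -/
theorem exists_coupling_of_cells (α : Measure A) (β : Measure B) [SigmaFinite α]
    [SigmaFinite β] {k : A → ℕ} {l : B → ℕ} (hk : Measurable k) (hl : Measurable l)
    (h : ∀ i, α (k ⁻¹' {i}) = β (l ⁻¹' {i})) (hα : ∀ i, α (k ⁻¹' {i}) ≠ ∞) :
    ∃ γ : Measure (A × B), MeasurePreserving Prod.fst γ α ∧ MeasurePreserving Prod.snd γ β ∧
      ∀ᵐ p ∂γ, k p.1 = l p.2 := by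
  obtain ⟨γ, h1, h2, h3⟩ := exists_coupling_of_matrix α β hk hl
    -- A diagonal matrix charges only pairs of points in cells of the same index.
    (fun i j => if i = j then α (k ⁻¹' {i}) else 0)
    (fun i => by simp) (fun j => by simp [h]) hα (fun j => h j ▸ hα j)
  refine ⟨γ, h1, h2, h3.mono fun p hp => ?_⟩
  by_contra hne
  simp [hne] at hp

end EqualMass

/-! ### Approximation in `L¹` by kernels built from rectangles -/

section Density

/-- `f` is a limit in `L¹` of functions satisfying `P`. -/
def L1Approximable {X : Type*} [MeasurableSpace X] (ν : Measure X) (P : (X → ℝ) → Prop)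
    (f : X → ℝ) : Prop :=
  ∀ ε : ℝ≥0∞, ε ≠ 0 → ∃ g, P g ∧ eLpNorm (f - g) 1 ν ≤ ε

variable {X : Type*} [MeasurableSpace X] {ν : Measure X} {P : (X → ℝ) → Prop}

theorem L1Approximable.of_self {f : X → ℝ} (hf : P f) : L1Approximable ν P f :=
  fun _ _ => ⟨f, hf, by simp⟩

theorem L1Approximable.trans (hP : ∀ g, P g → AEStronglyMeasurable g ν) {f : X → ℝ}
    (hf : AEStronglyMeasurable f ν)
    (h : ∀ ε : ℝ≥0∞, ε ≠ 0 → ∃ g, AEStronglyMeasurable g ν ∧ L1Approximable ν P g ∧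
      eLpNorm (f - g) 1 ν ≤ ε) : L1Approximable ν P f := by
  intro ε hε
  have hε2 : ε / 2 ≠ 0 := (ENNReal.half_pos hε).ne'
  obtain ⟨g, hgm, hg, hfg⟩ := h (ε / 2) hε2
  obtain ⟨k, hk, hgk⟩ := hg (ε / 2) hε2
  refine ⟨k, hk, ?_⟩
  calc eLpNorm (f - k) 1 ν = eLpNorm ((f - g) + (g - k)) 1 ν := by rw [sub_add_sub_cancel]
    _ ≤ eLpNorm (f - g) 1 ν + eLpNorm (g - k) 1 ν :=
      eLpNorm_add_le (hf.sub hgm) (hgm.sub (hP k hk)) le_rfl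
    _ ≤ ε / 2 + ε / 2 := add_le_add hfg hgk
    _ = ε := ENNReal.add_halves ε

theorem L1Approximable.add (hP : ∀ g, P g → AEStronglyMeasurable g ν)
    (hadd : ∀ f g, P f → P g → P (f + g)) {f g : X → ℝ} (hfm : AEStronglyMeasurable f ν)
    (hgm : AEStronglyMeasurable g ν) (hf : L1Approximable ν P f) (hg : L1Approximable ν P g) :
    L1Approximable ν P (f + g) := by
  intro ε hε
  have hε2 : ε / 2 ≠ 0 := (ENNReal.half_pos hε).ne'
  obtain ⟨f', hf', hff⟩ := hf (ε / 2) hε2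
  obtain ⟨g', hg', hgg⟩ := hg (ε / 2) hε2
  refine ⟨f' + g', hadd _ _ hf' hg', ?_⟩
  calc eLpNorm (f + g - (f' + g')) 1 ν = eLpNorm ((f - f') + (g - g')) 1 ν := by
        rw [add_sub_add_comm]
    _ ≤ eLpNorm (f - f') 1 ν + eLpNorm (g - g') 1 ν :=
      eLpNorm_add_le (hfm.sub (hP _ hf')) (hgm.sub (hP _ hg')) le_rfl
    _ ≤ ε / 2 + ε / 2 := add_le_add hff hgg
    _ = ε := ENNReal.add_halves ε

theorem L1Approximable.smul (hsmul : ∀ (c : ℝ) f, P f → P (c • f)) {f : X → ℝ} (c : ℝ)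
    (hf : L1Approximable ν P f) : L1Approximable ν P (c • f) := by
  intro ε hε
  by_cases hc : c = 0
  · obtain ⟨g, hg, -⟩ := hf 1 one_ne_zero
    exact ⟨c • g, hsmul _ _ hg, by simp [hc]⟩
  · have hc' : ‖c‖ₑ ≠ 0 := by simpa using hc
    obtain ⟨g, hg, hfg⟩ := hf (ε / ‖c‖ₑ) (ENNReal.div_pos hε enorm_ne_top).ne'
    refine ⟨c • g, hsmul _ _ hg, ?_⟩
    rw [← smul_sub, eLpNorm_const_smul]
    exact (mul_le_mul_right hfg _).trans (ENNReal.mul_div_le)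

theorem L1Approximable.indicator_iUnion_of_monotone (hP : ∀ g, P g → AEStronglyMeasurable g ν)
    {E : ℕ → Set X} (hE : ∀ n, MeasurableSet (E n)) (hmono : Monotone E) (hfin : ν (⋃ n, E n) ≠ ∞)
    (h : ∀ n, L1Approximable ν P ((E n).indicator 1)) :
    L1Approximable ν P ((⋃ n, E n).indicator 1) := by
  refine L1Approximable.trans hP
    (aestronglyMeasurable_one.indicator (MeasurableSet.iUnion hE)) fun ε hε => ?_
  have hlim : Filter.Tendsto (fun n => ν ((⋃ n, E n) \ E n)) Filter.atTop (nhds 0) := by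
    have h1 := tendsto_measure_iInter_atTop (μ := ν) (s := fun n => (⋃ n, E n) \ E n)
      (fun n => ((MeasurableSet.iUnion hE).diff (hE n)).nullMeasurableSet)
      (fun i j hij => Set.sdiff_subset_sdiff_right (hmono hij))
      ⟨0, ((measure_mono Set.sdiff_subset).trans_lt hfin.lt_top).ne⟩
    rwa [← Set.sdiff_iUnion, Set.sdiff_self, measure_empty] at h1
  obtain ⟨n, hn⟩ := (hlim.eventually_le_const (pos_iff_ne_zero.2 hε)).exists
  refine ⟨(E n).indicator 1, aestronglyMeasurable_one.indicator (hE n), h n, ?_⟩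
  have hsub : (⋃ n, E n).indicator (1 : X → ℝ) - (E n).indicator 1
      = ((⋃ n, E n) \ E n).indicator 1 := by
    rw [Set.indicator_sdiff (Set.subset_iUnion E n)]
  rw [hsub]
  refine le_trans (eLpNorm_indicator_const_le (1 : ℝ) 1) ?_
  simpa using hn

end Density

theorem measurableSet_accumulate {X : Type*} [MeasurableSpace X] {f : ℕ → Set X}
    (hf : ∀ n, MeasurableSet (f n)) (k : ℕ) : MeasurableSet (Set.accumulate f k) :=
  MeasurableSet.biUnion (Set.to_countable _) fun i _ => hf i

section Rectangles

variable {S : Type*} [MeasurableSpace S] {μ : Measure S} [SigmaFinite μ]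
  {ℛ : Set (Set S)} {C : ℕ → Set S} {P : (S × S → ℝ) → Prop}

/-- A π-λ argument. It is run inside a square of finite measure, with complements relative to that
square, so that all indicators are integrable. -/
theorem L1Approximable.indicator_inter_square
    (hgen : ‹MeasurableSpace S› = MeasurableSpace.generateFrom ℛ) (hpi : IsPiSystem ℛ)
    (huniv : Set.univ ∈ ℛ) (hCm : ∀ n, MeasurableSet (C n)) (hC : ∀ n, μ (C n) ≠ ∞)
    (hadd : ∀ f g, P f → P g → P (f + g)) (hsmul : ∀ (c : ℝ) f, P f → P (c • f))
    (hP : ∀ f, P f → AEStronglyMeasurable f (μ.prod μ))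
    (hrect : ∀ A ∈ ℛ, ∀ B ∈ ℛ, ∀ n, P (((A ∩ C n) ×ˢ (B ∩ C n)).indicator 1)) (n : ℕ)
    {E : Set (S × S)} (hE : MeasurableSet E) :
    L1Approximable (μ.prod μ) P ((E ∩ C n ×ˢ C n).indicator 1) := by
  have hCC : MeasurableSet (C n ×ˢ C n) := (hCm n).prod (hCm n)
  have hfin : (μ.prod μ) (C n ×ˢ C n) ≠ ∞ := by
    rw [Measure.prod_prod]
    exact ENNReal.mul_ne_top (hC n) (hC n)
  have hsq : L1Approximable (μ.prod μ) P ((C n ×ˢ C n).indicator 1) := by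
    have := hrect _ huniv _ huniv n
    simp only [Set.univ_inter] at this
    exact .of_self this
  have hspan : IsCountablySpanning ℛ := ⟨fun _ => Set.univ, fun _ => huniv, Set.iUnion_const _⟩
  have hgen2 : (Prod.instMeasurableSpace : MeasurableSpace (S × S)) =
      MeasurableSpace.generateFrom (Set.image2 (· ×ˢ ·) ℛ ℛ) := by
    rw [← generateFrom_prod_eq hspan hspan, ← hgen]
  have hzero : L1Approximable (μ.prod μ) P 0 := by
    simpa using hsq.smul hsmul 0
  induction E, hE using MeasurableSpace.induction_on_inter hgen2 (hpi.prod hpi) with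
  | empty =>
    rw [Set.empty_inter, Set.indicator_empty']
    exact hzero
  | basic t ht =>
    obtain ⟨A, hA, B, hB, rfl⟩ := ht
    rw [Set.prod_inter_prod]
    exact .of_self (hrect A hA B hB n)
  | compl t ht ih =>
    have : (tᶜ ∩ C n ×ˢ C n).indicator (1 : S × S → ℝ)
        = (C n ×ˢ C n).indicator 1 + (-1 : ℝ) • (t ∩ C n ×ˢ C n).indicator 1 := by
      ext p
      by_cases h1 : p ∈ t <;> by_cases h2 : p ∈ C n ×ˢ C n <;> simp [Set.indicator, h1, h2]
    rw [this]
    exact hsq.add hP hadd (aestronglyMeasurable_one.indicator hCC)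
      ((aestronglyMeasurable_one.indicator (ht.inter hCC)).const_smul _) (ih.smul hsmul _)
  | iUnion f hf hfm ih =>
    have hacc : ∀ k, L1Approximable (μ.prod μ) P
        ((Set.accumulate f k ∩ C n ×ˢ C n).indicator 1) := by
      intro k
      induction k with
      | zero => simpa using ih 0
      | succ k ihk =>
        have : (Set.accumulate f (k + 1) ∩ C n ×ˢ C n).indicator (1 : S × S → ℝ)
            = (Set.accumulate f k ∩ C n ×ˢ C n).indicator 1
              + (f (k + 1) ∩ C n ×ˢ C n).indicator 1 := by
          rw [Set.accumulate_succ, Set.union_inter_distrib_right]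
          refine Set.indicator_union_of_disjoint ?_ _
          refine Disjoint.mono Set.inter_subset_left Set.inter_subset_left ?_
          exact Set.disjoint_accumulate hf (Nat.lt_succ_self k)
        rw [this]
        exact ihk.add hP hadd (aestronglyMeasurable_one.indicator
          ((measurableSet_accumulate hfm k).inter hCC))
          (aestronglyMeasurable_one.indicator ((hfm _).inter hCC)) (ih _)
    rw [← Set.iUnion_accumulate, Set.iUnion_inter]
    refine L1Approximable.indicator_iUnion_of_monotone hP
      (fun k => (measurableSet_accumulate hfm k).inter hCC)
      (fun i j hij => Set.inter_subset_inter_left _ (Set.monotone_accumulate hij)) ?_ hacc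
    rw [← Set.iUnion_inter]
    exact ((measure_mono Set.inter_subset_right).trans_lt hfin.lt_top).ne

theorem prod_compl_iUnion_square_eq_zero (hmono : Monotone C) (hcov : μ (⋃ n, C n)ᶜ = 0) :
    (μ.prod μ) (⋃ n, C n ×ˢ C n)ᶜ = 0 := by
  have : (⋃ n, C n ×ˢ C n)ᶜ ⊆ (⋃ n, C n)ᶜ ×ˢ Set.univ ∪ Set.univ ×ˢ (⋃ n, C n)ᶜ := by
    rintro ⟨x, y⟩ h
    by_contra hne
    simp only [Set.mem_union, Set.mem_prod, Set.mem_compl_iff, Set.mem_univ, and_true, true_and,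
      not_or, not_not, Set.mem_iUnion] at hne
    obtain ⟨⟨i, hi⟩, ⟨j, hj⟩⟩ := hne
    exact h (Set.mem_iUnion.2 ⟨max i j, hmono (le_max_left i j) hi, hmono (le_max_right i j) hj⟩)
  refine measure_mono_null this (measure_union_null ?_ ?_) <;> rw [Measure.prod_prod, hcov] <;> simp

/-- The class `P` is left abstract for two uses: as the class of step kernels, and as the class of
kernels whose integrals converge along a sequence of measures. -/
theorem exists_eLpNorm_sub_le_of_rectangles
    (hgen : ‹MeasurableSpace S› = MeasurableSpace.generateFrom ℛ) (hpi : IsPiSystem ℛ)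
    (huniv : Set.univ ∈ ℛ) (hCm : ∀ n, MeasurableSet (C n)) (hmono : Monotone C)
    (hC : ∀ n, μ (C n) ≠ ∞) (hcov : μ (⋃ n, C n)ᶜ = 0)
    (hadd : ∀ f g, P f → P g → P (f + g)) (hsmul : ∀ (c : ℝ) f, P f → P (c • f))
    (hP : ∀ f, P f → AEStronglyMeasurable f (μ.prod μ))
    (hrect : ∀ A ∈ ℛ, ∀ B ∈ ℛ, ∀ n, P (((A ∩ C n) ×ˢ (B ∩ C n)).indicator 1))
    {F : S × S → ℝ} (hF : Integrable F (μ.prod μ)) {ε : ℝ≥0∞} (hε : ε ≠ 0) :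
    ∃ g, P g ∧ eLpNorm (F - g) 1 (μ.prod μ) ≤ ε := by
  have key : ∀ E : Set (S × S), MeasurableSet E → (μ.prod μ) E < ∞ →
      L1Approximable (μ.prod μ) P (E.indicator 1) := by
    intro E hE hfin
    have h1 := L1Approximable.indicator_iUnion_of_monotone (ν := μ.prod μ) hP
      (E := fun n => E ∩ C n ×ˢ C n) (fun n => hE.inter ((hCm n).prod (hCm n)))
      (fun i j hij => Set.inter_subset_inter_right _ (Set.prod_mono (hmono hij) (hmono hij)))
      ((measure_mono (Set.iUnion_subset fun _ => Set.inter_subset_left)).trans_lt hfin).ne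
      (fun n => L1Approximable.indicator_inter_square hgen hpi huniv hCm hC hadd hsmul hP hrect n
        hE)
    intro δ hδ
    obtain ⟨g, hg, hle⟩ := h1 δ hδ
    refine ⟨g, hg, le_of_eq_of_le (eLpNorm_congr_ae ?_) hle⟩
    have h0 := prod_compl_iUnion_square_eq_zero hmono hcov
    rw [← Set.inter_iUnion]
    filter_upwards [compl_mem_ae_iff.2 h0] with p hp
    simp only [compl_compl] at hp
    by_cases hpE : p ∈ E <;> simp [Set.indicator, hpE, hp]
  have hbase : ∀ (c : ℝ) ⦃s : Set (S × S)⦄, MeasurableSet s → (μ.prod μ) s < ∞ →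
      ∀ {ε : ℝ≥0∞}, ε ≠ 0 →
        ∃ g, eLpNorm (g - s.indicator fun _ => c) 1 (μ.prod μ) ≤ ε ∧ P g := by
    intro c s hs hfin ε hε
    obtain ⟨g, hg, hle⟩ := (key s hs hfin).smul hsmul c ε hε
    refine ⟨g, ?_, hg⟩
    rw [eLpNorm_sub_comm]
    convert hle using 3
    ext p
    by_cases hp : p ∈ s <;> simp [Set.indicator, hp]
  obtain ⟨g, h1, h2⟩ := MemLp.induction_dense ENNReal.one_ne_top P hbase hadd hP
    (memLp_one_iff_integrable.2 hF) hε
  exact ⟨g, h2, h1⟩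

end Rectangles

/-! ### Step kernels -/

section StepKernels

variable {S : Type*} [MeasurableSpace S]

/-- `g` is constant on the products of the cells, all of finite measure, of a countable measurable
partition, and vanishes off the square of a set of finite measure. -/
def IsStepKernel (μ : Measure S) (g : S × S → ℝ) : Prop :=
  ∃ (q : S → ℕ) (k : ℕ → ℕ → ℝ) (E : Set S), Measurable q ∧ (∀ i, μ (q ⁻¹' {i}) ≠ ∞) ∧
    MeasurableSet E ∧ μ E ≠ ∞ ∧ (∀ p, g p = k (q p.1) (q p.2)) ∧
    ∀ p, ¬ (p.1 ∈ E ∧ p.2 ∈ E) → g p = 0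

theorem IsStepKernel.measurable {μ : Measure S} {g : S × S → ℝ} (h : IsStepKernel μ g) :
    Measurable g := by
  obtain ⟨q, k, E, hq, -, -, -, hg, -⟩ := h
  have : g = (fun r : ℕ × ℕ => k r.1 r.2) ∘ Prod.map q q := funext hg
  rw [this]
  exact (measurable_of_countable _).comp (hq.prodMap hq)

/-- The common refinement of the two partitions, indexed through `Nat.pair`, has finite cells
because each lies in a cell of the first one. -/
theorem IsStepKernel.add {μ : Measure S} {f g : S × S → ℝ} (hf : IsStepKernel μ f)
    (hg : IsStepKernel μ g) : IsStepKernel μ (f + g) := by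
  obtain ⟨q, k, E, hq, hqf, hE, hEf, hk, h0⟩ := hf
  obtain ⟨q', k', E', hq', -, hE', hEf', hk', h0'⟩ := hg
  refine ⟨fun x => Nat.pair (q x) (q' x),
    fun i j => k i.unpair.1 j.unpair.1 + k' i.unpair.2 j.unpair.2, E ∪ E',
    (measurable_of_countable fun r : ℕ × ℕ => Nat.pair r.1 r.2).comp (hq.prodMk hq'), ?_,
    hE.union hE', measure_union_ne_top hEf hEf', ?_, ?_⟩
  · refine fun i => ((measure_mono ?_).trans_lt (hqf i.unpair.1).lt_top).ne
    rintro x rfl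
    simp
  · intro p
    simp [hk, hk']
  · intro p hp
    rw [Pi.add_apply, h0 p fun h => hp ⟨Or.inl h.1, Or.inl h.2⟩,
      h0' p fun h => hp ⟨Or.inr h.1, Or.inr h.2⟩, add_zero]

theorem IsStepKernel.smul {μ : Measure S} (c : ℝ) {f : S × S → ℝ} (hf : IsStepKernel μ f) :
    IsStepKernel μ (c • f) := by
  obtain ⟨q, k, E, hq, hqf, hE, hEf, hk, h0⟩ := hf
  exact ⟨q, fun i j => c * k i j, E, hq, hqf, hE, hEf, fun p => by simp [hk],
    fun p hp => by simp [h0 p hp]⟩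

theorem isStepKernel_indicator_prod (μ : Measure S) [SigmaFinite μ] {A B : Set S}
    (hA : MeasurableSet A) (hB : MeasurableSet B) (hAf : μ A ≠ ∞) (hBf : μ B ≠ ∞) :
    IsStepKernel μ ((A ×ˢ B).indicator 1) := by
  classical
  -- The index records membership in `A` and in `B`; the component `spanningSetsIndex` serves only
  -- to make the cells finite.
  refine ⟨fun x => Nat.pair (spanningSetsIndex μ x)
      (Nat.pair (if x ∈ A then 1 else 0) (if x ∈ B then 1 else 0)),
    fun i j => if i.unpair.2.unpair.1 = 1 ∧ j.unpair.2.unpair.2 = 1 then 1 else 0, A ∪ B, ?_, ?_,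
    hA.union hB, measure_union_ne_top hAf hBf, ?_, ?_⟩
  · exact (measurable_of_countable fun r : ℕ × ℕ × ℕ => Nat.pair r.1 (Nat.pair r.2.1 r.2.2)).comp
      ((measurableSet_spanningSetsIndex μ).prodMk
        ((Measurable.ite hA measurable_const measurable_const).prodMk
          (Measurable.ite hB measurable_const measurable_const)))
  · refine fun i => ((measure_mono ?_).trans_lt
      (measure_preimage_spanningSetsIndex_ne_top μ i.unpair.1).lt_top).ne
    rintro x rfl
    simp
  · rintro ⟨x, y⟩
    by_cases hx : x ∈ A <;> by_cases hy : y ∈ B <;> simp [Set.indicator, hx, hy]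
  · rintro ⟨x, y⟩ h
    refine Set.indicator_of_notMem ?_ _
    rintro ⟨hx, hy⟩
    exact h ⟨Or.inl hx, Or.inr hy⟩

theorem exists_isStepKernel_eLpNorm_sub_le {μ : Measure S} [SigmaFinite μ] {F : S × S → ℝ}
    (hF : Integrable F (μ.prod μ)) {ε : ℝ≥0∞} (hε : ε ≠ 0) :
    ∃ g, IsStepKernel μ g ∧ eLpNorm (F - g) 1 (μ.prod μ) ≤ ε := by
  have hfin : ∀ (A : Set S) n, μ (A ∩ spanningSets μ n) ≠ ∞ := fun A n =>
    ((measure_mono Set.inter_subset_right).trans_lt (measure_spanningSets_lt_top μ n)).ne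
  refine exists_eLpNorm_sub_le_of_rectangles (ℛ := {A | MeasurableSet A})
    MeasurableSpace.generateFrom_measurableSet.symm MeasurableSpace.isPiSystem_measurableSet
    MeasurableSet.univ (measurableSet_spanningSets μ) (monotone_spanningSets μ)
    (fun n => (measure_spanningSets_lt_top μ n).ne) (by simp [iUnion_spanningSets])
    (fun f g hf hg => hf.add hg) (fun c f hf => hf.smul c)
    (fun f hf => hf.measurable.aestronglyMeasurable) (fun A hA B hB n => ?_) hF hε
  exact isStepKernel_indicator_prod μ (MeasurableSet.inter hA (measurableSet_spanningSets μ n))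
    (MeasurableSet.inter hB (measurableSet_spanningSets μ n)) (hfin A n) (hfin B n)

end StepKernels

/-! ### The `L¹` norm of kernels under measure-preserving maps -/

section NormLOne

variable {S : Type u} [MeasurableSpace S] {μ : Measure S}

theorem normLOne_congr {F F' : S → S → ℝ} (h : ∀ᵐ p ∂(μ.prod μ), F p.1 p.2 = F' p.1 p.2) :
    normLOne μ F = normLOne μ F' :=
  eLpNorm_congr_ae h

theorem normLOne_sub_le {F F' : S → S → ℝ}
    (hF : AEStronglyMeasurable (fun p : S × S => F p.1 p.2) (μ.prod μ))
    (hF' : AEStronglyMeasurable (fun p : S × S => F' p.1 p.2) (μ.prod μ)) :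
    normLOne μ (fun x y => F x y - F' x y) ≤ normLOne μ F + normLOne μ F' :=
  eLpNorm_sub_le hF hF' le_rfl

theorem normLOne_add_le {F F' : S → S → ℝ}
    (hF : AEStronglyMeasurable (fun p : S × S => F p.1 p.2) (μ.prod μ))
    (hF' : AEStronglyMeasurable (fun p : S × S => F' p.1 p.2) (μ.prod μ)) :
    normLOne μ (fun x y => F x y + F' x y) ≤ normLOne μ F + normLOne μ F' :=
  eLpNorm_add_le hF hF' le_rfl

theorem normLOne_sub_comm (F F' : S → S → ℝ) :
    normLOne μ (fun x y => F x y - F' x y) = normLOne μ (fun x y => F' x y - F x y) :=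
  eLpNorm_sub_comm _ _ _ _

theorem normLOne_mono {F F' : S → S → ℝ} (h : ∀ x y, ‖F x y‖ ≤ ‖F' x y‖) :
    normLOne μ F ≤ normLOne μ F' :=
  eLpNorm_mono fun p => h p.1 p.2

theorem normLOne_mono_measure {ν : Measure S} [SFinite μ] [SFinite ν] (h : μ ≤ ν)
    (F : S → S → ℝ) : normLOne μ F ≤ normLOne ν F :=
  eLpNorm_mono_measure _ (Measure.prod_mono h h)

variable {T : Type u} [MeasurableSpace T] {ν : Measure T}

theorem MeasureTheory.MeasurePreserving.normLOne_comp [SFinite μ] [SFinite ν] {φ : S → T}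
    (hφ : MeasurePreserving φ μ ν)
    {F : T → T → ℝ} (hF : AEStronglyMeasurable (fun p : T × T => F p.1 p.2) (ν.prod ν)) :
    normLOne μ (fun x y => F (φ x) (φ y)) = normLOne ν F :=
  eLpNorm_comp_measurePreserving (f := Prod.map φ φ) (g := fun p : T × T => F p.1 p.2) hF
    (hφ.prod hφ)

theorem MeasureTheory.MeasurePreserving.aestronglyMeasurable_comp_square [SFinite μ] {φ : S → T}
    (hφ : MeasurePreserving φ μ ν)
    {F : T → T → ℝ} (hF : AEStronglyMeasurable (fun p : T × T => F p.1 p.2) (ν.prod ν)) :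
    AEStronglyMeasurable (fun p : S × S => F (φ p.1) (φ p.2)) (μ.prod μ) :=
  hF.comp_measurePreserving (hφ.prod hφ)

theorem ae_prod_and {p q : S → Prop} (hp : ∀ᵐ x ∂μ, p x) (hq : ∀ᵐ x ∂μ, q x) :
    ∀ᵐ z ∂(μ.prod μ), p z.1 ∧ q z.2 :=
  (Measure.quasiMeasurePreserving_fst.ae hp).and (Measure.quasiMeasurePreserving_snd.ae hq)

end NormLOne

/-! ### Cutting a coupling down to subsets of equal mass -/

section Recoupling

variable {Y : Type u} [MeasurableSpace Y]

/-- The common part `Y₁ ∩ Y₂ ∩ E` is coupled with itself inside the cells of `q`. It has finite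
measure, so the remainders of `Y₁` and `Y₂` have equal masses by subtraction and are coupled
arbitrarily. The set `E` is there to allow this subtraction when `Y₁` and `Y₂` have infinite mass.
-/
theorem exists_coupling_restrict {π : Measure Y} [SigmaFinite π] {Y₁ Y₂ E : Set Y}
    (hY₁ : MeasurableSet Y₁) (hY₂ : MeasurableSet Y₂) (hE : MeasurableSet E) (hEf : π E ≠ ∞)
    (hmass : π Y₁ = π Y₂) {q : Y → ℕ} (hq : Measurable q) (hqf : ∀ i, π (q ⁻¹' {i}) ≠ ∞) :
    ∃ γ : Measure (Y × Y), MeasurePreserving Prod.fst γ (π.restrict Y₁) ∧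
      MeasurePreserving Prod.snd γ (π.restrict Y₂) ∧
      ∀ᵐ p ∂γ, (p.1 ∈ Y₁ ∩ Y₂ ∩ E ∧ p.2 ∈ Y₁ ∩ Y₂ ∩ E ∧ q p.1 = q p.2) ∨
        (p.1 ∉ Y₁ ∩ Y₂ ∩ E ∧ p.2 ∉ Y₁ ∩ Y₂ ∩ E) := by
  set Z := Y₁ ∩ Y₂ ∩ E
  have hZm : MeasurableSet Z := (hY₁.inter hY₂).inter hE
  have hZf : π Z ≠ ∞ := ((measure_mono Set.inter_subset_right).trans_lt hEf.lt_top).ne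
  have hZ1 : Z ⊆ Y₁ := fun x hx => hx.1.1
  have hZ2 : Z ⊆ Y₂ := fun x hx => hx.1.2
  obtain ⟨γ₀, h1, h2, h3⟩ := exists_coupling_of_cells (π.restrict Z) (π.restrict Z) hq hq
    (fun _ => rfl) (fun i => ((Measure.restrict_apply_le _ _).trans_lt (hqf i).lt_top).ne)
  obtain ⟨γ₁, h1', h2'⟩ := exists_coupling_of_measure_univ_eq (π.restrict (Y₁ \ Z))
    (π.restrict (Y₂ \ Z)) (by
      rw [Measure.restrict_apply_univ, Measure.restrict_apply_univ,
        measure_sdiff hZ1 hZm.nullMeasurableSet hZf, measure_sdiff hZ2 hZm.nullMeasurableSet hZf,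
        hmass])
  have hsplit : ∀ {X : Set Y}, Z ⊆ X → π.restrict Z + π.restrict (X \ Z) = π.restrict X := by
    intro X hX
    have := Measure.restrict_inter_add_sdiff (μ := π) X hZm
    rwa [Set.inter_eq_right.2 hX] at this
  refine ⟨γ₀ + γ₁, ⟨measurable_fst, ?_⟩, ⟨measurable_snd, ?_⟩, ?_⟩
  · rw [Measure.map_add _ _ measurable_fst, h1.map_eq, h1'.map_eq, hsplit hZ1]
  · rw [Measure.map_add _ _ measurable_snd, h2.map_eq, h2'.map_eq, hsplit hZ2]
  · rw [ae_add_measure_iff]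
    constructor
    · filter_upwards [h3, h1.quasiMeasurePreserving.ae (ae_restrict_mem hZm),
        h2.quasiMeasurePreserving.ae (ae_restrict_mem hZm)] with p hp hp1 hp2
      exact Or.inl ⟨hp1, hp2, hp⟩
    · filter_upwards [h1'.quasiMeasurePreserving.ae (ae_restrict_mem (hY₁.diff hZm)),
        h2'.quasiMeasurePreserving.ae (ae_restrict_mem (hY₂.diff hZm))] with p hp1 hp2
      exact Or.inr ⟨hp1.2, hp2.2⟩

/-- Two kernels on the same space that vanish off the squares of sets `Y₁` and `Y₂` of equal mass
are compared by a coupling of `Y₁` and `Y₂`. -/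
theorem exists_coupling_normLOne_le {π : Measure Y} [SigmaFinite π] {Y₁ Y₂ : Set Y}
    (hY₁ : MeasurableSet Y₁) (hY₂ : MeasurableSet Y₂) (hmass : π Y₁ = π Y₂) {F₁ F₂ : Y → Y → ℝ}
    (hF₁ : Integrable (fun p : Y × Y => F₁ p.1 p.2) (π.prod π))
    (hF₂ : Integrable (fun p : Y × Y => F₂ p.1 p.2) (π.prod π))
    (h₁ : ∀ x y, ¬ (x ∈ Y₁ ∧ y ∈ Y₁) → F₁ x y = 0) (h₂ : ∀ x y, ¬ (x ∈ Y₂ ∧ y ∈ Y₂) → F₂ x y = 0)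
    {ε : ℝ≥0∞} (hε : ε ≠ 0) :
    ∃ γ : Measure (Y × Y), MeasurePreserving Prod.fst γ (π.restrict Y₁) ∧
      MeasurePreserving Prod.snd γ (π.restrict Y₂) ∧
      normLOne γ (fun p p' => F₁ p.1 p'.1 - F₂ p.2 p'.2) ≤
        3 * normLOne π (fun x y => F₁ x y - F₂ x y) + ε := by
  obtain ⟨g, hg, hle⟩ := exists_isStepKernel_eLpNorm_sub_le hF₁ (ENNReal.half_pos hε).ne'
  have hgm := hg.measurable
  obtain ⟨q, k, E, hq, hqf, hE, hEf, hgk, hg0⟩ := hg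
  obtain ⟨γ, hγ1, hγ2, hγ⟩ := exists_coupling_restrict hY₁ hY₂ hE hEf hmass hq hqf
  refine ⟨γ, hγ1, hγ2, ?_⟩
  have : SigmaFinite γ := SigmaFinite.of_map γ hγ1.measurable.aemeasurable (by
    rw [hγ1.map_eq]; infer_instance)
  set Z := Y₁ ∩ Y₂ ∩ E
  have hZm : MeasurableSet Z := (hY₁.inter hY₂).inter hE
  -- The step kernel truncated to `Z × Z` takes the same value on both sides of the coupling almost
  -- everywhere, so it can be subtracted from both `F₁` and `F₂`.
  set h : Y → Y → ℝ := fun x y => (Z ×ˢ Z).indicator g (x, y) with hh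
  have hhm : Measurable (fun p : Y × Y => h p.1 p.2) := hgm.indicator (hZm.prod hZm)
  have hd : normLOne π (fun x y => F₁ x y - g (x, y)) ≤ ε / 2 := hle
  have hF₁m := hF₁.aestronglyMeasurable
  have hF₂m := hF₂.aestronglyMeasurable
  have hgm' : AEStronglyMeasurable (fun p : Y × Y => g (p.1, p.2)) (π.prod π) :=
    hgm.aestronglyMeasurable
  have hhm' := fun ν : Measure (Y × Y) => hhm.aestronglyMeasurable (μ := ν)
  -- Where `h` is truncated to `0`: outside `E × E` already `g = 0`, while inside `E × E` one of
  -- `F₁`, `F₂` vanishes, so that `|F₁| ≤ |F₁ - F₂|`.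
  have hpt1 : ∀ x y, |F₁ x y - h x y| ≤ |F₁ x y - g (x, y)| + |F₁ x y - F₂ x y| := by
    intro x y
    by_cases hxy : x ∈ Z ∧ y ∈ Z
    · have : h x y = g (x, y) := Set.indicator_of_mem (show (x, y) ∈ Z ×ˢ Z from hxy) _
      rw [this]
      linarith [abs_nonneg (F₁ x y - F₂ x y)]
    · have : h x y = 0 := Set.indicator_of_notMem (show (x, y) ∉ Z ×ˢ Z from hxy) _
      rw [this, sub_zero]
      by_cases hE' : x ∈ E ∧ y ∈ E
      · by_cases hY1 : x ∈ Y₁ ∧ y ∈ Y₁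
        · have : F₂ x y = 0 := h₂ x y fun hY2 =>
            hxy ⟨⟨⟨hY1.1, hY2.1⟩, hE'.1⟩, ⟨⟨hY1.2, hY2.2⟩, hE'.2⟩⟩
          rw [this, sub_zero]
          linarith [abs_nonneg (F₁ x y - g (x, y))]
        · rw [h₁ x y hY1, abs_zero]
          positivity
      · rw [hg0 (x, y) hE', sub_zero]
        linarith [abs_nonneg (F₁ x y - F₂ x y)]
  -- Passing from `F₁` to `F₂` costs one more `|F₁ - F₂|`. The two bounds add up to the factor `3`.
  have hpt2 : ∀ x y, |F₂ x y - h x y| ≤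
      |F₁ x y - g (x, y)| + |F₁ x y - F₂ x y| + |F₁ x y - F₂ x y| := by
    intro x y
    have h1 := abs_sub_le (F₂ x y) (F₁ x y) (h x y)
    rw [abs_sub_comm (F₂ x y) (F₁ x y)] at h1
    linarith [hpt1 x y]
  set d := normLOne π (fun x y => F₁ x y - F₂ x y)
  have hm1 := (hF₁m.sub hgm').norm
  have hm2 := (hF₁m.sub hF₂m).norm
  have hn1 : normLOne π (fun x y => |F₁ x y - g (x, y)|) ≤ ε / 2 :=
    le_trans (normLOne_mono fun x y => by simp) hd
  have hn2 : normLOne π (fun x y => |F₁ x y - F₂ x y|) ≤ d := normLOne_mono fun x y => by simp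
  have hb1 : normLOne π (fun x y => F₁ x y - h x y) ≤ ε / 2 + d := by
    refine le_trans (normLOne_mono fun x y => ?_) ((normLOne_add_le hm1 hm2).trans
      (add_le_add hn1 hn2))
    exact (hpt1 x y).trans (le_abs_self _)
  have hb2 : normLOne π (fun x y => F₂ x y - h x y) ≤ ε / 2 + d + d := by
    refine le_trans (normLOne_mono fun x y => ?_) ((normLOne_add_le (hm1.add hm2) hm2).trans
      (add_le_add ((normLOne_add_le hm1 hm2).trans (add_le_add hn1 hn2)) hn2))
    exact (hpt2 x y).trans (le_abs_self _)
  have hac : ∀ X : Set Y, (π.restrict X).prod (π.restrict X) ≪ π.prod π := fun X =>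
    Measure.AbsolutelyContinuous.prod Measure.restrict_le_self.absolutelyContinuous
      Measure.restrict_le_self.absolutelyContinuous
  have hk1 := ((hF₁m.sub (hhm' _)).mono_ac (hac Y₁))
  have hk2 := ((hF₂m.sub (hhm' _)).mono_ac (hac Y₂))
  calc normLOne γ (fun p p' => F₁ p.1 p'.1 - F₂ p.2 p'.2)
      = normLOne γ (fun p p' => (F₁ p.1 p'.1 - h p.1 p'.1) - (F₂ p.2 p'.2 - h p.2 p'.2)) := by
        refine normLOne_congr ?_
        filter_upwards [ae_prod_and hγ hγ] with ⟨p, p'⟩ hp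
        suffices h p.1 p'.1 = h p.2 p'.2 by simp only [this]; ring
        obtain ⟨hp, hp'⟩ := hp
        simp only at hp hp'
        rcases hp with ⟨h1, h2, h3⟩ | ⟨h1, h2⟩
        · rcases hp' with ⟨h1', h2', h3'⟩ | ⟨h1', h2'⟩
          · rw [hh]
            simp only [Set.indicator, Set.mem_prod, h1, h2, h1', h2', and_self, if_true, hgk, h3,
              h3']
          · simp only [hh, Set.indicator, Set.mem_prod, h1', h2', and_false, if_false]
        · simp only [hh, Set.indicator, Set.mem_prod, h1, h2, false_and, if_false]
    _ ≤ normLOne γ (fun p p' => F₁ p.1 p'.1 - h p.1 p'.1)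
        + normLOne γ (fun p p' => F₂ p.2 p'.2 - h p.2 p'.2) :=
      normLOne_sub_le
        (hγ1.aestronglyMeasurable_comp_square (F := fun x y => F₁ x y - h x y) hk1)
        (hγ2.aestronglyMeasurable_comp_square (F := fun x y => F₂ x y - h x y) hk2)
    _ = normLOne (π.restrict Y₁) (fun x y => F₁ x y - h x y)
        + normLOne (π.restrict Y₂) (fun x y => F₂ x y - h x y) := by
      rw [← hγ1.normLOne_comp (F := fun x y => F₁ x y - h x y) hk1,
        ← hγ2.normLOne_comp (F := fun x y => F₂ x y - h x y) hk2]
    _ ≤ (ε / 2 + d) + (ε / 2 + d + d) :=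
      add_le_add ((normLOne_mono_measure Measure.restrict_le_self _).trans hb1)
        ((normLOne_mono_measure Measure.restrict_le_self _).trans hb2)
    _ = 3 * d + (ε / 2 + ε / 2) := by ring
    _ = 3 * d + ε := by rw [ENNReal.add_halves]

end Recoupling

/-! ### Measurable embeddings and restricted measures -/

section Embedding

variable {X Y Z : Type*} [MeasurableSpace X] [MeasurableSpace Y] [MeasurableSpace Z]

theorem MeasurableEmbedding.sigmaFinite_comap {e : X → Y} (he : MeasurableEmbedding e)
    (m : Measure Y) [SigmaFinite m] : SigmaFinite (m.comap e) :=
  SigmaFinite.of_map _ he.measurable.aemeasurable (by rw [he.map_comap]; infer_instance)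

theorem MeasurableEmbedding.measurePreserving_comap {e : X → Y} (he : MeasurableEmbedding e)
    (m : Measure Y) : MeasurePreserving e (m.comap e) (m.restrict (Set.range e)) :=
  ⟨he.measurable, he.map_comap m⟩

theorem MeasurableEmbedding.map_prodMap_comap {e : X → Y} (he : MeasurableEmbedding e)
    (m : Measure Y) [SigmaFinite m] :
    ((m.comap e).prod (m.comap e)).map (Prod.map e e)
      = (m.prod m).restrict (Set.range e ×ˢ Set.range e) := by
  have := he.sigmaFinite_comap m
  rw [← Measure.map_prod_map _ _ he.measurable he.measurable, he.map_comap,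
    Measure.prod_restrict]

theorem MeasurableEmbedding.integrable_prod_comap_iff {e : X → Y} (he : MeasurableEmbedding e)
    {m : Measure Y} [SigmaFinite m] {F : Y → Y → ℝ}
    (h0 : ∀ x y, ¬ (x ∈ Set.range e ∧ y ∈ Set.range e) → F x y = 0) :
    Integrable (fun p : X × X => F (e p.1) (e p.2)) ((m.comap e).prod (m.comap e)) ↔
      Integrable (fun p : Y × Y => F p.1 p.2) (m.prod m) := by
  have h1 : Integrable (fun p : X × X => F (e p.1) (e p.2)) ((m.comap e).prod (m.comap e)) ↔
      Integrable (fun p : Y × Y => F p.1 p.2)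
        (((m.comap e).prod (m.comap e)).map (Prod.map e e)) :=
    ((he.prodMap he).integrable_map_iff (g := fun p : Y × Y => F p.1 p.2)).symm
  rw [h1, he.map_prodMap_comap]
  refine integrableOn_iff_integrable_of_support_subset fun p hp => ?_
  by_contra hne
  exact hp (h0 p.1 p.2 hne)

theorem MeasurableEmbedding.ae_prod_of_comap {e : X → Y} (he : MeasurableEmbedding e)
    {m : Measure Y} [SigmaFinite m] {p : Y × Y → Prop}
    (h : ∀ᵐ z ∂((m.comap e).prod (m.comap e)), p (e z.1, e z.2))
    (h0 : ∀ x y, ¬ (x ∈ Set.range e ∧ y ∈ Set.range e) → p (x, y)) :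
    ∀ᵐ z ∂(m.prod m), p z := by
  have h1 : ∀ᵐ z ∂(((m.comap e).prod (m.comap e)).map (Prod.map e e)), p z :=
    (he.prodMap he).ae_map_iff.2 h
  rw [he.map_prodMap_comap,
    ae_restrict_iff' (he.measurableSet_range.prod he.measurableSet_range)] at h1
  filter_upwards [h1] with z hz
  by_cases hm : z ∈ Set.range e ×ˢ Set.range e
  · exact hz hm
  · exact h0 z.1 z.2 hm

theorem MeasureTheory.MeasurePreserving.of_comp_measurableEmbedding {e : X → Y}
    (he : MeasurableEmbedding e) {m : Measure Y} {κ : Measure Z} {φ : Z → X}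
    (h : MeasurePreserving (e ∘ φ) κ (m.restrict (Set.range e))) :
    MeasurePreserving φ κ (m.comap e) := by
  have hφ : Measurable φ := he.measurable_comp_iff.1 h.measurable
  refine ⟨hφ, Measure.ext fun A hA => ?_⟩
  rw [Measure.map_apply hφ hA, he.comap_apply]
  have h1 := h.measure_preimage (he.measurableSet_image.2 hA).nullMeasurableSet
  rw [Measure.restrict_apply (he.measurableSet_image.2 hA),
    Set.inter_eq_left.2 (Set.image_subset_range _ _), Set.preimage_comp,
    Set.preimage_image_eq _ he.injective] at h1
  exact h1

end Embedding

/-! ### The `L¹` distance: symmetry, pull-backs, transitivity -/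

namespace Graphon

theorem aestronglyMeasurable (G : Graphon.{u}) :
    AEStronglyMeasurable (fun p : G.S × G.S => G.W p.1 p.2) (G.μ.prod G.μ) :=
  G.integrable.aestronglyMeasurable

theorem distLOneEqualMass_comm_le (G₁ G₂ : Graphon.{u}) :
    distLOneEqualMass G₁ G₂ ≤ distLOneEqualMass G₂ G₁ := by
  refine le_iInf fun c => ?_
  refine (iInf_le _ (⟨c.S, c.μ, c.φ₂, c.φ₁, c.measurePreserving₂, c.measurePreserving₁⟩ :
    Coupling G₁.μ G₂.μ)).trans (le_of_eq ?_)
  exact normLOne_sub_comm _ _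

theorem distLOneEqualMass_comm (G₁ G₂ : Graphon.{u}) :
    distLOneEqualMass G₁ G₂ = distLOneEqualMass G₂ G₁ :=
  le_antisymm (distLOneEqualMass_comm_le _ _) (distLOneEqualMass_comm_le _ _)

theorem IsPullback.distLOneEqualMass_eq_zero {G₁ G₂ : Graphon.{u}} (h : G₁.IsPullback G₂) :
    distLOneEqualMass G₁ G₂ = 0 := by
  obtain ⟨φ, hφ, hW⟩ := h
  refine le_antisymm ?_ zero_le
  refine (iInf_le _ (⟨G₁.S, G₁.μ, id, φ, MeasurePreserving.id _, hφ⟩ :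
    Coupling G₁.μ G₂.μ)).trans (le_of_eq ?_)
  rw [normLOne_congr (F' := fun _ _ => 0) (hW.mono fun p hp => sub_eq_zero.2 hp)]
  exact eLpNorm_zero

theorem IsPullback.refl (G : Graphon.{u}) : G.IsPullback G :=
  ⟨id, MeasurePreserving.id _, Filter.Eventually.of_forall fun _ => rfl⟩

/-- An approximate gluing of `c` and `d` over `G₂`. Let `g` be a step kernel close to `G₂.W`. Its
cells have the same masses when pulled back to `c.S` and to `d.S`, so these spaces can be coupled
along them. The two pull-backs of `g` then coincide a.e. and cancel, and each replacement of `G₂.W`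
by `g` costs at most `ε / 2`. -/
theorem distLOneEqualMass_le_normLOne_add {G₁ G₂ G₃ : Graphon.{u}} (c : Coupling G₁.μ G₂.μ)
    (d : Coupling G₂.μ G₃.μ) {ε : ℝ≥0∞} (hε : ε ≠ 0) :
    distLOneEqualMass G₁ G₃ ≤
      normLOne c.μ (fun x y => G₁.pullback c.φ₁ x y - G₂.pullback c.φ₂ x y) +
        normLOne d.μ (fun x y => G₂.pullback d.φ₁ x y - G₃.pullback d.φ₂ x y) + ε := by
  obtain ⟨g, hg, hle⟩ := exists_isStepKernel_eLpNorm_sub_le G₂.integrable (ENNReal.half_pos hε).ne'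
  have hgm := hg.measurable
  obtain ⟨q, k, -, hq, hqf, -, -, hgk, -⟩ := hg
  have hc := fun i => c.measurePreserving₂.measure_preimage
    (hq (measurableSet_singleton i)).nullMeasurableSet
  have hd := fun i => d.measurePreserving₁.measure_preimage
    (hq (measurableSet_singleton i)).nullMeasurableSet
  obtain ⟨γ, h1, h2, h3⟩ := exists_coupling_of_cells c.μ d.μ
    (hq.comp c.measurePreserving₂.measurable) (hq.comp d.measurePreserving₁.measurable)
    (fun i => by rw [Set.preimage_comp, Set.preimage_comp, hc, hd])
    (fun i => by rw [Set.preimage_comp, hc]; exact hqf i)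
  have : SigmaFinite γ := SigmaFinite.of_map γ h1.measurable.aemeasurable (by
    rw [h1.map_eq]; infer_instance)
  refine (iInf_le _ (⟨c.S × d.S, γ, c.φ₁ ∘ Prod.fst, d.φ₂ ∘ Prod.snd,
    c.measurePreserving₁.comp h1, d.measurePreserving₂.comp h2⟩ :
      Coupling G₁.μ G₃.μ)).trans ?_
  have hgm' : AEStronglyMeasurable (fun p : G₂.S × G₂.S => g (p.1, p.2)) (G₂.μ.prod G₂.μ) :=
    hgm.aestronglyMeasurable
  have hWg := G₂.aestronglyMeasurable.sub hgm'
  have hWgc := c.measurePreserving₂.aestronglyMeasurable_comp_square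
    (F := fun x y => G₂.W x y - g (x, y)) hWg
  have hWgd := d.measurePreserving₁.aestronglyMeasurable_comp_square
    (F := fun x y => G₂.W x y - g (x, y)) hWg
  have hcm := (c.measurePreserving₁.aestronglyMeasurable_comp_square G₁.aestronglyMeasurable).sub
    (c.measurePreserving₂.aestronglyMeasurable_comp_square G₂.aestronglyMeasurable)
  have hdm := (d.measurePreserving₁.aestronglyMeasurable_comp_square G₂.aestronglyMeasurable).sub
    (d.measurePreserving₂.aestronglyMeasurable_comp_square G₃.aestronglyMeasurable)
  have hcm' : AEStronglyMeasurable (fun p : c.S × c.S =>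
      (G₁.pullback c.φ₁ p.1 p.2 - G₂.pullback c.φ₂ p.1 p.2)
        + (G₂.W (c.φ₂ p.1) (c.φ₂ p.2) - g (c.φ₂ p.1, c.φ₂ p.2))) (c.μ.prod c.μ) := hcm.add hWgc
  have hdm' : AEStronglyMeasurable (fun p : d.S × d.S =>
      (G₂.W (d.φ₁ p.1) (d.φ₁ p.2) - g (d.φ₁ p.1, d.φ₁ p.2))
        - (G₂.pullback d.φ₁ p.1 p.2 - G₃.pullback d.φ₂ p.1 p.2)) (d.μ.prod d.μ) := hWgd.sub hdm
  calc normLOne γ (fun p p' => G₁.pullback (c.φ₁ ∘ Prod.fst) p p'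
          - G₃.pullback (d.φ₂ ∘ Prod.snd) p p')
      = normLOne γ (fun p p' =>
          ((G₁.pullback c.φ₁ p.1 p'.1 - G₂.pullback c.φ₂ p.1 p'.1)
            + (G₂.W (c.φ₂ p.1) (c.φ₂ p'.1) - g (c.φ₂ p.1, c.φ₂ p'.1)))
          - ((G₂.W (d.φ₁ p.2) (d.φ₁ p'.2) - g (d.φ₁ p.2, d.φ₁ p'.2))
            - (G₂.pullback d.φ₁ p.2 p'.2 - G₃.pullback d.φ₂ p.2 p'.2))) := by
        refine normLOne_congr ?_
        filter_upwards [ae_prod_and h3 h3] with ⟨p, p'⟩ hp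
        obtain ⟨hp, hp'⟩ := hp
        simp only [Function.comp_apply] at hp hp'
        simp only [hgk, hp, hp', Graphon.pullback, Function.comp_apply]
        ring
    _ ≤ normLOne γ (fun p p' =>
          (G₁.pullback c.φ₁ p.1 p'.1 - G₂.pullback c.φ₂ p.1 p'.1)
            + (G₂.W (c.φ₂ p.1) (c.φ₂ p'.1) - g (c.φ₂ p.1, c.φ₂ p'.1)))
        + normLOne γ (fun p p' =>
          (G₂.W (d.φ₁ p.2) (d.φ₁ p'.2) - g (d.φ₁ p.2, d.φ₁ p'.2))
            - (G₂.pullback d.φ₁ p.2 p'.2 - G₃.pullback d.φ₂ p.2 p'.2)) :=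
      normLOne_sub_le
        (h1.aestronglyMeasurable_comp_square (F := fun x y =>
          (G₁.pullback c.φ₁ x y - G₂.pullback c.φ₂ x y)
            + (G₂.W (c.φ₂ x) (c.φ₂ y) - g (c.φ₂ x, c.φ₂ y))) hcm')
        (h2.aestronglyMeasurable_comp_square (F := fun x y =>
          (G₂.W (d.φ₁ x) (d.φ₁ y) - g (d.φ₁ x, d.φ₁ y))
            - (G₂.pullback d.φ₁ x y - G₃.pullback d.φ₂ x y)) hdm')
    _ = normLOne c.μ (fun x y => (G₁.pullback c.φ₁ x y - G₂.pullback c.φ₂ x y)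
            + (G₂.W (c.φ₂ x) (c.φ₂ y) - g (c.φ₂ x, c.φ₂ y)))
        + normLOne d.μ (fun x y => (G₂.W (d.φ₁ x) (d.φ₁ y) - g (d.φ₁ x, d.φ₁ y))
            - (G₂.pullback d.φ₁ x y - G₃.pullback d.φ₂ x y)) := by
      rw [← h1.normLOne_comp hcm', ← h2.normLOne_comp hdm']
    _ ≤ (normLOne c.μ (fun x y => G₁.pullback c.φ₁ x y - G₂.pullback c.φ₂ x y)
          + normLOne c.μ (fun x y => G₂.W (c.φ₂ x) (c.φ₂ y) - g (c.φ₂ x, c.φ₂ y)))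
        + (normLOne d.μ (fun x y => G₂.W (d.φ₁ x) (d.φ₁ y) - g (d.φ₁ x, d.φ₁ y))
          + normLOne d.μ (fun x y => G₂.pullback d.φ₁ x y - G₃.pullback d.φ₂ x y)) :=
      add_le_add (normLOne_add_le hcm hWgc) (normLOne_sub_le hWgd hdm)
    _ ≤ (normLOne c.μ (fun x y => G₁.pullback c.φ₁ x y - G₂.pullback c.φ₂ x y) + ε / 2)
        + (ε / 2 + normLOne d.μ (fun x y => G₂.pullback d.φ₁ x y - G₃.pullback d.φ₂ x y)) := by
      rw [c.measurePreserving₂.normLOne_comp (F := fun x y => G₂.W x y - g (x, y)) hWg,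
        d.measurePreserving₁.normLOne_comp (F := fun x y => G₂.W x y - g (x, y)) hWg]
      have hle' : normLOne G₂.μ (fun x y => G₂.W x y - g (x, y)) ≤ ε / 2 := hle
      gcongr
    _ = normLOne c.μ (fun x y => G₁.pullback c.φ₁ x y - G₂.pullback c.φ₂ x y) +
        normLOne d.μ (fun x y => G₂.pullback d.φ₁ x y - G₃.pullback d.φ₂ x y)
          + (ε / 2 + ε / 2) := by ring
    _ = _ := by rw [ENNReal.add_halves]

theorem exists_coupling_normLOne_lt {G₁ G₂ : Graphon.{u}} (h : distLOneEqualMass G₁ G₂ = 0)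
    {ε : ℝ≥0∞} (hε : ε ≠ 0) : ∃ c : Coupling G₁.μ G₂.μ,
      normLOne c.μ (fun x y => G₁.pullback c.φ₁ x y - G₂.pullback c.φ₂ x y) < ε := by
  have : distLOneEqualMass G₁ G₂ < ε := h ▸ pos_iff_ne_zero.2 hε
  exact iInf_lt_iff.1 this

theorem distLOneEqualMass_trans {G₁ G₂ G₃ : Graphon.{u}} (h₁ : distLOneEqualMass G₁ G₂ = 0)
    (h₂ : distLOneEqualMass G₂ G₃ = 0) : distLOneEqualMass G₁ G₃ = 0 := by
  refine le_antisymm (ENNReal.le_of_forall_pos_le_add fun ε hε _ => ?_) zero_le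
  have hε' : (ε : ℝ≥0∞) / 3 ≠ 0 := (ENNReal.div_pos (by exact_mod_cast hε.ne') (by simp)).ne'
  obtain ⟨c, hc⟩ := exists_coupling_normLOne_lt h₁ hε'
  obtain ⟨d, hd⟩ := exists_coupling_normLOne_lt h₂ hε'
  refine (distLOneEqualMass_le_normLOne_add c d hε').trans ?_
  rw [zero_add]
  calc _ ≤ (ε : ℝ≥0∞) / 3 + ε / 3 + ε / 3 := by gcongr
    _ = ε := ENNReal.add_thirds _

end Graphon

theorem MeasurableEmbedding.sumInl {S T : Type*} [MeasurableSpace S] [MeasurableSpace T] :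
    MeasurableEmbedding (Sum.inl : S → S ⊕ T) :=
  ⟨Sum.inl_injective, measurable_inl, fun _ hs => hs.inl_image⟩

theorem MeasurableEmbedding.sumInr {S T : Type*} [MeasurableSpace S] [MeasurableSpace T] :
    MeasurableEmbedding (Sum.inr : T → S ⊕ T) :=
  ⟨Sum.inr_injective, measurable_inr, fun _ hs => measurableSet_inr_image.2 hs⟩

/-! ### Removal of trivial extensions -/

namespace Graphon

theorem IsTrivialExtension.refl (G : Graphon.{u}) : G.IsTrivialExtension G :=
  ⟨id, MeasurableEmbedding.id, Measure.comap_id _, fun _ _ => rfl, fun x y h => by simp at h⟩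

/-- If the trivial extensions of two graphons of equal mass have distance `0`, then so do the
graphons. -/
theorem distLOneEqualMass_eq_zero_of_isTrivialExtension {G₁ G₂ H₁ H₂ : Graphon.{u}}
    (h₁ : H₁.IsTrivialExtension G₁) (h₂ : H₂.IsTrivialExtension G₂)
    (hmass : G₁.μ Set.univ = G₂.μ Set.univ) (h : distLOneEqualMass H₁ H₂ = 0) :
    distLOneEqualMass G₁ G₂ = 0 := by
  obtain ⟨ι₁, hι₁, hμ₁, hW₁, hW₁'⟩ := h₁
  obtain ⟨ι₂, hι₂, hμ₂, hW₂, hW₂'⟩ := h₂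
  refine le_antisymm (ENNReal.le_of_forall_pos_le_add fun ε hε _ => ?_) zero_le
  have hε' : (ε : ℝ≥0∞) / 4 ≠ 0 := (ENNReal.div_pos (by exact_mod_cast hε.ne') (by simp)).ne'
  obtain ⟨c, hc⟩ := exists_coupling_normLOne_lt h hε'
  have hr₁ := hι₁.measurableSet_range
  have hr₂ := hι₂.measurableSet_range
  set Y₁ := c.φ₁ ⁻¹' Set.range ι₁
  set Y₂ := c.φ₂ ⁻¹' Set.range ι₂
  have hY₁ : MeasurableSet Y₁ := c.measurePreserving₁.measurable hr₁
  have hY₂ : MeasurableSet Y₂ := c.measurePreserving₂.measurable hr₂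
  -- The parts of the coupling that lie over `G₁` and over `G₂` may be different sets, but they have
  -- the masses of `G₁` and `G₂`, which agree. Hence they can be coupled anew.
  have hm : c.μ Y₁ = c.μ Y₂ := by
    rw [c.measurePreserving₁.measure_preimage hr₁.nullMeasurableSet,
      c.measurePreserving₂.measure_preimage hr₂.nullMeasurableSet, ← Set.image_univ,
      ← Set.image_univ, ← hι₁.comap_apply, ← hι₂.comap_apply, hμ₁, hμ₂, hmass]
  have hF₁ : Integrable (fun p : c.S × c.S => H₁.pullback c.φ₁ p.1 p.2) (c.μ.prod c.μ) :=
    (c.measurePreserving₁.prod c.measurePreserving₁).integrable_comp_of_integrable H₁.integrable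
  have hF₂ : Integrable (fun p : c.S × c.S => H₂.pullback c.φ₂ p.1 p.2) (c.μ.prod c.μ) :=
    (c.measurePreserving₂.prod c.measurePreserving₂).integrable_comp_of_integrable H₂.integrable
  obtain ⟨γ, hγ₁, hγ₂, hle⟩ := exists_coupling_normLOne_le hY₁ hY₂ hm hF₁ hF₂
    (fun x y hxy => hW₁' _ _ hxy) (fun x y hxy => hW₂' _ _ hxy) hε'
  have : SigmaFinite γ := SigmaFinite.of_map γ hγ₁.measurable.aemeasurable (by
    rw [hγ₁.map_eq]; infer_instance)
  set s : Set (c.S × c.S) := Y₁ ×ˢ Y₂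
  have hs : MeasurableSet s := hY₁.prod hY₂
  have he : MeasurableEmbedding (Subtype.val : s → c.S × c.S) := MeasurableEmbedding.subtype_coe hs
  have := he.sigmaFinite_comap γ
  -- The new coupling lives on `Y₁ × Y₂`, where both components lift through `ι₁` and `ι₂`; on the
  -- subtype the lifts `f₁` and `f₂` are defined everywhere.
  have hval : MeasurePreserving (Subtype.val : s → c.S × c.S) (γ.comap Subtype.val) γ := by
    have h0 := he.measurePreserving_comap γ
    rwa [Subtype.range_coe, Measure.restrict_eq_self_of_ae_mem] at h0
    filter_upwards [hγ₁.quasiMeasurePreserving.ae (ae_restrict_mem hY₁),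
      hγ₂.quasiMeasurePreserving.ae (ae_restrict_mem hY₂)] with p hp hp'
    exact ⟨hp, hp'⟩
  choose f₁ hf₁ using fun p : s => p.2.1
  choose f₂ hf₂ using fun p : s => p.2.2
  have hmp₁ : MeasurePreserving f₁ (γ.comap Subtype.val) G₁.μ := by
    rw [← hμ₁]
    refine MeasurePreserving.of_comp_measurableEmbedding hι₁ ?_
    have : ι₁ ∘ f₁ = c.φ₁ ∘ Prod.fst ∘ Subtype.val := funext hf₁
    rw [this]
    exact (c.measurePreserving₁.restrict_preimage hr₁).comp (hγ₁.comp hval)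
  have hmp₂ : MeasurePreserving f₂ (γ.comap Subtype.val) G₂.μ := by
    rw [← hμ₂]
    refine MeasurePreserving.of_comp_measurableEmbedding hι₂ ?_
    have : ι₂ ∘ f₂ = c.φ₂ ∘ Prod.snd ∘ Subtype.val := funext hf₂
    rw [this]
    exact (c.measurePreserving₂.restrict_preimage hr₂).comp (hγ₂.comp hval)
  have hac : ∀ X : Set c.S, (c.μ.restrict X).prod (c.μ.restrict X) ≪ c.μ.prod c.μ := fun X =>
    Measure.AbsolutelyContinuous.prod Measure.restrict_le_self.absolutelyContinuous
      Measure.restrict_le_self.absolutelyContinuous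
  have hmeas : AEStronglyMeasurable (fun r : (c.S × c.S) × (c.S × c.S) =>
      H₁.pullback c.φ₁ r.1.1 r.2.1 - H₂.pullback c.φ₂ r.1.2 r.2.2) (γ.prod γ) :=
    (hγ₁.aestronglyMeasurable_comp_square (hF₁.aestronglyMeasurable.mono_ac (hac Y₁))).sub
      (hγ₂.aestronglyMeasurable_comp_square (hF₂.aestronglyMeasurable.mono_ac (hac Y₂)))
  refine (iInf_le _ (⟨s, γ.comap Subtype.val, f₁, f₂, hmp₁, hmp₂⟩ : Coupling G₁.μ G₂.μ)).trans ?_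
  have hG : (fun x y : s => G₁.pullback f₁ x y - G₂.pullback f₂ x y) = fun x y : s =>
      H₁.pullback c.φ₁ x.1.1 y.1.1 - H₂.pullback c.φ₂ x.1.2 y.1.2 := by
    funext x y
    simp only [pullback, ← hW₁, ← hW₂, hf₁, hf₂]
  rw [zero_add]
  calc normLOne (γ.comap Subtype.val) (fun x y : s => G₁.pullback f₁ x y - G₂.pullback f₂ x y)
      = normLOne γ (fun p p' => H₁.pullback c.φ₁ p.1 p'.1 - H₂.pullback c.φ₂ p.2 p'.2) := by
        rw [hG]
        exact hval.normLOne_comp (F := fun p p' : c.S × c.S =>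
          H₁.pullback c.φ₁ p.1 p'.1 - H₂.pullback c.φ₂ p.2 p'.2) hmeas
    _ ≤ 3 * (ε / 4) + ε / 4 := hle.trans (by gcongr)
    _ = 4 * (ε / 4) := by ring
    _ = ε := ENNReal.mul_div_cancel (by simp) (by simp)

/-! ### Stabilization: from a chain to `δ₁ = 0` -/

section Stabilize

/-- The trivial extension of a graphon by countably many atoms of mass `1`. -/
noncomputable def stabilizeMeasure {S : Type u} [MeasurableSpace S] (μ : Measure S) :
    Measure (S ⊕ ULift.{u} ℕ) :=
  μ.map Sum.inl + Measure.count.map Sum.inr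

instance {S : Type u} [MeasurableSpace S] (μ : Measure S) [SigmaFinite μ] :
    SigmaFinite (stabilizeMeasure μ) := by
  have h1 : SigmaFinite (μ.map (Sum.inl : S → S ⊕ ULift.{u} ℕ)) :=
    MeasurableEmbedding.sumInl.sigmaFinite_map
  have h2 : SigmaFinite ((Measure.count : Measure (ULift.{u} ℕ)).map
      (Sum.inr : ULift.{u} ℕ → S ⊕ ULift.{u} ℕ)) :=
    MeasurableEmbedding.sumInr.sigmaFinite_map
  unfold stabilizeMeasure
  infer_instance

theorem comap_inl_stabilizeMeasure {S : Type u} [MeasurableSpace S] (μ : Measure S) :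
    (stabilizeMeasure μ).comap Sum.inl = μ := by
  ext s hs
  have h := MeasurableEmbedding.sumInl (S := S) (T := ULift.{u} ℕ)
  have hm := h.measurableSet_image.2 hs
  rw [h.comap_apply, stabilizeMeasure, Measure.add_apply, Measure.map_apply measurable_inl hm,
    Measure.map_apply measurable_inr hm, Set.preimage_image_eq _ Sum.inl_injective]
  have : (Sum.inr ⁻¹' (Sum.inl '' s) : Set (ULift.{u} ℕ)) = ∅ := by
    ext x
    simp
  rw [this, measure_empty, add_zero]

theorem stabilizeMeasure_univ {S : Type u} [MeasurableSpace S] (μ : Measure S) :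
    stabilizeMeasure μ Set.univ = ∞ := by
  rw [stabilizeMeasure, Measure.add_apply, Measure.map_apply measurable_inr MeasurableSet.univ,
    Set.preimage_univ, Measure.count_apply_infinite Set.infinite_univ, add_top]

/-- The extension by `0` of a kernel on `S` to `S ⊕ T`. -/
def extendKernel {S T : Type*} (W : S → S → ℝ) : S ⊕ T → S ⊕ T → ℝ
  | .inl x, .inl y => W x y
  | _, _ => 0

theorem extendKernel_eq_zero {S T : Type*} (W : S → S → ℝ) (x y : S ⊕ T)
    (h : ¬ (x ∈ Set.range Sum.inl ∧ y ∈ Set.range Sum.inl)) : extendKernel W x y = 0 := by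
  rcases x with x | x <;> rcases y with y | y <;> simp_all [extendKernel]

/-- The trivial extension of a graphon by countably many atoms of mass `1`. -/
noncomputable def stabilize (G : Graphon.{u}) : Graphon.{u} where
  S := G.S ⊕ ULift.{u} ℕ
  μ := stabilizeMeasure G.μ
  W := extendKernel G.W
  symm x y := by rcases x with x | x <;> rcases y with y | y <;> simp [extendKernel, G.symm]
  integrable := by
    rw [← MeasurableEmbedding.sumInl.integrable_prod_comap_iff (extendKernel_eq_zero G.W),
      comap_inl_stabilizeMeasure]
    exact G.integrable

theorem stabilize_isTrivialExtension (G : Graphon.{u}) : G.stabilize.IsTrivialExtension G :=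
  ⟨Sum.inl, MeasurableEmbedding.sumInl, comap_inl_stabilizeMeasure G.μ, fun _ _ => rfl,
    extendKernel_eq_zero G.W⟩

theorem IsPullback.stabilize {G₁ G₂ : Graphon.{u}} (h : G₁.IsPullback G₂) :
    G₁.stabilize.IsPullback G₂.stabilize := by
  obtain ⟨φ, hφ, hW⟩ := h
  have hm : Measurable (Sum.map φ (id : ULift.{u} ℕ → ULift.{u} ℕ)) :=
    (measurable_inl.comp hφ.measurable).sumElim (measurable_inr.comp measurable_id)
  refine ⟨Sum.map φ id, ⟨hm, ?_⟩, ?_⟩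
  · change (stabilizeMeasure G₁.μ).map _ = stabilizeMeasure G₂.μ
    rw [stabilizeMeasure, Measure.map_add _ _ hm, Measure.map_map hm measurable_inl,
      Measure.map_map hm measurable_inr, stabilizeMeasure, ← hφ.map_eq,
      Measure.map_map measurable_inl hφ.measurable]
    rfl
  · change ∀ᵐ z ∂((stabilizeMeasure G₁.μ).prod (stabilizeMeasure G₁.μ)),
      extendKernel G₁.W z.1 z.2 = extendKernel G₂.W (Sum.map φ id z.1) (Sum.map φ id z.2)
    refine MeasurableEmbedding.sumInl.ae_prod_of_comap ?_ ?_
    · rw [comap_inl_stabilizeMeasure]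
      exact hW
    · intro x y hxy
      rw [extendKernel_eq_zero _ _ _ hxy, extendKernel_eq_zero]
      rcases x with x | x <;> rcases y with y | y <;> simp_all

theorem IsTrivialExtension.stabilize {H G : Graphon.{u}} (h : H.IsTrivialExtension G) :
    H.stabilize.IsTrivialExtension G.stabilize := by
  obtain ⟨ι, hι, hμ, hW, hW'⟩ := h
  have hm : Measurable (Sum.map ι (id : ULift.{u} ℕ → ULift.{u} ℕ)) :=
    (measurable_inl.comp hι.measurable).sumElim (measurable_inr.comp measurable_id)
  have himage : ∀ s : Set (G.S ⊕ ULift.{u} ℕ), Sum.map ι id '' s =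
      Sum.inl '' (ι '' (Sum.inl ⁻¹' s)) ∪ Sum.inr '' (Sum.inr ⁻¹' s) := by
    intro s
    ext (x | x) <;> simp
  have he : MeasurableEmbedding (Sum.map ι (id : ULift.{u} ℕ → ULift.{u} ℕ)) := by
    refine ⟨Sum.map_injective.2 ⟨hι.injective, Function.injective_id⟩, hm, fun s hs => ?_⟩
    rw [himage]
    exact (MeasurableEmbedding.sumInl.measurableSet_image.2
      (hι.measurableSet_image.2 (measurable_inl hs))).union
        (MeasurableEmbedding.sumInr.measurableSet_image.2 (measurable_inr hs))
  refine ⟨Sum.map ι id, he, ?_, ?_, ?_⟩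
  · change (stabilizeMeasure H.μ).comap _ = stabilizeMeasure G.μ
    ext s hs
    have hms := he.measurableSet_image.2 hs
    rw [he.comap_apply, stabilizeMeasure, stabilizeMeasure, Measure.add_apply, Measure.add_apply,
      Measure.map_apply measurable_inl hms, Measure.map_apply measurable_inr hms,
      Measure.map_apply measurable_inl hs, Measure.map_apply measurable_inr hs, ← hμ,
      hι.comap_apply]
    congr 2
    · ext x
      simp
    · ext x
      simp
  · rintro (x | x) (y | y)
    · exact hW x y
    all_goals rfl
  · rintro (x | x) (y | y) hxy
    · refine hW' x y fun h => hxy ?_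
      obtain ⟨⟨a, rfl⟩, ⟨b, rfl⟩⟩ := h
      exact ⟨⟨.inl a, rfl⟩, ⟨.inl b, rfl⟩⟩
    all_goals rfl

theorem stabilize_mass (G : Graphon.{u}) : G.stabilize.μ Set.univ = ∞ :=
  stabilizeMeasure_univ G.μ

/-- The graphon `H.stabilize` is a trivial extension both of itself and of `G.stabilize`, all of
mass `∞`, and it has distance `0` from itself. -/
theorem IsTrivialExtension.distLOneEqualMass_stabilize {H G : Graphon.{u}}
    (h : H.IsTrivialExtension G) : distLOneEqualMass H.stabilize G.stabilize = 0 :=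
  distLOneEqualMass_eq_zero_of_isTrivialExtension (IsTrivialExtension.refl _) h.stabilize
    (by rw [stabilize_mass, stabilize_mass]) (IsPullback.refl _).distLOneEqualMass_eq_zero

theorem ElementarilyEquivalent.distLOneEqualMass_stabilize {G₁ G₂ : Graphon.{u}}
    (h : ElementarilyEquivalent G₁ G₂) : distLOneEqualMass G₁.stabilize G₂.stabilize = 0 := by
  rcases h with (h | h) | (h | h)
  · exact h.stabilize.distLOneEqualMass_eq_zero
  · rw [distLOneEqualMass_comm]
    exact h.stabilize.distLOneEqualMass_eq_zero
  · exact h.distLOneEqualMass_stabilize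
  · rw [distLOneEqualMass_comm]
    exact h.distLOneEqualMass_stabilize

/-- If the masses agree, the added atoms are removed from both sides; otherwise the stabilizations
compete in the infimum that defines the distance. -/
theorem distLOne_eq_zero_of_stabilize {G₁ G₂ : Graphon.{u}}
    (h : distLOneEqualMass G₁.stabilize G₂.stabilize = 0) : distLOne G₁ G₂ = 0 := by
  unfold distLOne extendDist
  split_ifs with hm
  · exact distLOneEqualMass_eq_zero_of_isTrivialExtension G₁.stabilize_isTrivialExtension
      G₂.stabilize_isTrivialExtension hm h
  · refine le_antisymm ?_ zero_le
    rw [← h]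
    exact iInf_le_of_le G₁.stabilize (iInf_le_of_le G₂.stabilize
      (iInf_le_of_le G₁.stabilize_isTrivialExtension
        (iInf_le_of_le G₂.stabilize_isTrivialExtension
          (iInf_le _ (by rw [stabilize_mass, stabilize_mass])))))

theorem distLOne_eq_zero_of_chain {W W' : Graphon.{u}} (N : ℕ) (V : Fin (N + 1) → Graphon.{u})
    (h0 : V 0 = W) (hN : V (Fin.last N) = W')
    (h : ∀ i : Fin N, ElementarilyEquivalent (V i.castSucc) (V i.succ)) : distLOne W W' = 0 := by
  apply distLOne_eq_zero_of_stabilize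
  have key : ∀ i : Fin (N + 1), distLOneEqualMass (V 0).stabilize (V i).stabilize = 0 := by
    intro i
    induction i using Fin.induction with
    | zero => exact (IsPullback.refl _).distLOneEqualMass_eq_zero
    | succ i ih => exact distLOneEqualMass_trans ih (h i).distLOneEqualMass_stabilize
  rw [← h0, ← hN]
  exact key _

end Stabilize

/-! ### Comparison of the two distances -/

theorem cutNorm_le_normLOne {S : Type u} [MeasurableSpace S] (μ : Measure S) (F : S → S → ℝ) :
    cutNorm μ F ≤ normLOne μ F := by
  refine iSup_le fun T => iSup_le fun U => iSup_le fun _ => iSup_le fun _ => ?_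
  refine (enorm_integral_le_lintegral_enorm _).trans ?_
  rw [normLOne, eLpNorm_one_eq_lintegral_enorm]
  exact setLIntegral_le_lintegral _ _

theorem cutDist_le_distLOne (G₁ G₂ : Graphon.{u}) : cutDist G₁ G₂ ≤ distLOne G₁ G₂ := by
  have h : ∀ H₁ H₂ : Graphon.{u}, cutDistEqualMass H₁ H₂ ≤ distLOneEqualMass H₁ H₂ :=
    fun H₁ H₂ => iInf_mono fun c => cutNorm_le_normLOne _ _
  unfold cutDist distLOne extendDist
  split_ifs
  · exact h _ _
  · exact iInf_mono fun H₁ => iInf_mono fun H₂ => iInf_mono fun _ => iInf_mono fun _ =>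
      iInf_mono fun _ => h _ _

end Graphon

/-! ### Coding by the Cantor space -/

/-- The Cantor space, in any universe. -/
abbrev CantorSpace : Type u := ℕ → ULift.{u} Bool

/-- The origin of the Cantor space. -/
def cantorZero : CantorSpace.{u} := fun _ => ⟨false⟩

/-- The `i`-th coordinate set `{z | z i = 1}`. -/
def cantorCylinder (i : ℕ) : Set CantorSpace.{u} :=
  (fun z : CantorSpace.{u} => z i) ⁻¹' {(⟨true⟩ : ULift.{u} Bool)}

theorem mem_cantorCylinder {i : ℕ} {z : CantorSpace.{u}} : z ∈ cantorCylinder i ↔ z i = ⟨true⟩ :=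
  Iff.rfl

theorem isClopen_cantorCylinder (i : ℕ) : IsClopen (cantorCylinder.{u} i) := by
  have h : Continuous (fun z : CantorSpace.{u} => z i) := continuous_apply i
  exact (isClopen_discrete _).preimage h

theorem measurableSet_cantorCylinder (i : ℕ) : MeasurableSet (cantorCylinder.{u} i) :=
  (isClopen_cantorCylinder i).isOpen.measurableSet

/-- Away from the origin the space is exhausted by clopen sets, on which the measures below are
finite. The origin is the code of the points in none of the coding sets, hence of the points added
by a trivial extension. -/
theorem iUnion_cantorCylinder : ⋃ i, cantorCylinder.{u} i = {cantorZero}ᶜ := by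
  ext z
  simp only [Set.mem_iUnion, mem_cantorCylinder, Set.mem_compl_iff, Set.mem_singleton_iff]
  constructor
  · rintro ⟨i, hi⟩ rfl
    simp [cantorZero] at hi
  · intro h
    by_contra! hne
    refine h (funext fun i => ?_)
    rcases hz : z i with ⟨_ | _⟩
    · rfl
    · exact absurd hz (hne i)

open Classical in
/-- The map to the Cantor space given by the indicator functions of a sequence of sets. -/
noncomputable def cantorCode {S : Type*} (E : ℕ → Set S) : S → CantorSpace.{u} :=
  fun x i => ⟨decide (x ∈ E i)⟩

theorem cantorCode_preimage_cylinder {S : Type*} (E : ℕ → Set S) (i : ℕ) :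
    cantorCode.{u} E ⁻¹' cantorCylinder i = E i := by
  ext x
  simp [cantorCode, mem_cantorCylinder]

theorem cantorCode_eq_zero_iff {S : Type*} (E : ℕ → Set S) (x : S) :
    cantorCode.{u} E x = cantorZero ↔ x ∉ ⋃ i, E i := by
  have h : cantorCode.{u} E x ∈ ({cantorZero}ᶜ : Set CantorSpace.{u}) ↔ x ∈ ⋃ i, E i := by
    rw [← iUnion_cantorCylinder]
    simp only [Set.mem_iUnion]
    exact exists_congr fun i => by
      rw [← Set.mem_preimage, cantorCode_preimage_cylinder]
  rw [← h]
  simp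

theorem measurable_cantorCode {S : Type*} [MeasurableSpace S] {E : ℕ → Set S}
    (hE : ∀ i, MeasurableSet (E i)) : Measurable (cantorCode.{u} E) := by
  refine measurable_pi_lambda _ fun i => ?_
  refine measurable_up.comp (measurable_to_bool (f := fun x => (cantorCode.{u} E x i).down) ?_)
  have : (fun x => (cantorCode.{u} E x i).down) ⁻¹' {true} = E i := by
    ext x
    simp [cantorCode]
  rw [this]
  exact hE i

/-! ### Reduction of a kernel to countably many sets -/

section CountablyGenerated

theorem MeasurableSpace.prod_self_mono {S : Type*} {m m' : MeasurableSpace S} (h : m ≤ m') :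
    m.prod m ≤ m'.prod m' :=
  sup_le_sup (MeasurableSpace.comap_mono h) (MeasurableSpace.comap_mono h)

variable {S : Type*} [MeasurableSpace S]

/-- The sets measurable for the square of some countably generated sub-σ-algebra contain the
rectangles and are closed under complements and countable unions, because countably many generating
families can be merged. -/
theorem exists_countable_measurableSet_prod {E : Set (S × S)} (hE : MeasurableSet E) :
    ∃ 𝓢 : Set (Set S), 𝓢.Countable ∧ (∀ s ∈ 𝓢, MeasurableSet s) ∧
      MeasurableSet[(MeasurableSpace.generateFrom 𝓢).prod (MeasurableSpace.generateFrom 𝓢)] E := by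
  induction E, hE using MeasurableSpace.induction_on_inter generateFrom_prod.symm
    isPiSystem_prod with
  | empty => exact ⟨∅, Set.countable_empty, by simp, @MeasurableSet.empty _ (_)⟩
  | basic t ht =>
    obtain ⟨A, hA, B, hB, rfl⟩ := ht
    refine ⟨{A, B}, Set.to_countable _, ?_, ?_⟩
    · rintro s (rfl | rfl)
      exacts [hA, hB]
    · exact @MeasurableSet.prod _ _ (_) (_) _ _
        (MeasurableSpace.measurableSet_generateFrom (by simp))
        (MeasurableSpace.measurableSet_generateFrom (by simp))
  | compl t ht ih =>
    obtain ⟨𝓢, h1, h2, h3⟩ := ih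
    exact ⟨𝓢, h1, h2, @MeasurableSet.compl _ _ (_) h3⟩
  | iUnion f hf hfm ih =>
    choose 𝓢 h1 h2 h3 using ih
    refine ⟨⋃ i, 𝓢 i, Set.countable_iUnion h1, ?_, ?_⟩
    · intro s hs
      obtain ⟨i, hi⟩ := Set.mem_iUnion.1 hs
      exact h2 i s hi
    · exact @MeasurableSet.iUnion _ _ (_) _ _ fun i => MeasurableSpace.prod_self_mono
        (MeasurableSpace.generateFrom_mono (Set.subset_iUnion 𝓢 i)) _ (h3 i)

theorem exists_countable_measurable_prod {g : S × S → ℝ} (hg : Measurable g) :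
    ∃ 𝓢 : Set (Set S), 𝓢.Countable ∧ (∀ s ∈ 𝓢, MeasurableSet s) ∧
      Measurable[(MeasurableSpace.generateFrom 𝓢).prod (MeasurableSpace.generateFrom 𝓢)] g := by
  choose 𝓢 h1 h2 h3 using fun q : ℚ => exists_countable_measurableSet_prod
    (hg (measurableSet_Iio (a := (q : ℝ))))
  refine ⟨⋃ q, 𝓢 q, Set.countable_iUnion h1, ?_, ?_⟩
  · intro s hs
    obtain ⟨i, hi⟩ := Set.mem_iUnion.1 hs
    exact h2 i s hi
  · rw [show (Real.measurableSpace : MeasurableSpace ℝ) = borel ℝ from rfl,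
      Real.borel_eq_generateFrom_Iio_rat]
    refine @measurable_generateFrom _ _ ((MeasurableSpace.generateFrom (⋃ q, 𝓢 q)).prod
      (MeasurableSpace.generateFrom (⋃ q, 𝓢 q))) _ _ ?_
    intro t ht
    obtain ⟨q, rfl⟩ := Set.mem_iUnion.1 ht
    exact MeasurableSpace.prod_self_mono
      (MeasurableSpace.generateFrom_mono (Set.subset_iUnion 𝓢 q)) _ (h3 q)

/-- A measurable function on a square is a function of countably many indicator functions of
measurable sets of finite measure that cover the space. -/
theorem exists_cantorCode_factorization (μ : Measure S) [SigmaFinite μ] {g : S × S → ℝ}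
    (hg : Measurable g) : ∃ E : ℕ → Set S, (∀ i, MeasurableSet (E i)) ∧ (∀ i, μ (E i) ≠ ∞) ∧
      ⋃ i, E i = Set.univ ∧ ∃ V : CantorSpace.{u} × CantorSpace.{u} → ℝ, Measurable V ∧
        ∀ x y, g (x, y) = V (cantorCode E x, cantorCode E y) := by
  obtain ⟨𝓢, hc, hm, hgm⟩ := exists_countable_measurable_prod hg
  -- The whole space is added to the generators so that the sets `E i` cover it.
  obtain ⟨f, hf⟩ := (hc.insert Set.univ).exists_eq_range (Set.insert_nonempty _ _)
  have hfm : ∀ i, MeasurableSet (f i) := by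
    intro i
    have : f i ∈ insert Set.univ 𝓢 := hf ▸ Set.mem_range_self i
    rcases this with h | h
    · rw [h]; exact MeasurableSet.univ
    · exact hm _ h
  -- Each generator is cut into pieces of finite measure, from which it is recovered as a union.
  set E : ℕ → Set S := fun i => f i.unpair.1 ∩ spanningSets μ i.unpair.2
  have hE : ∀ i, ⋃ n, E (Nat.pair i n) = f i := by
    intro i
    simp only [E, Nat.unpair_pair]
    rw [← Set.inter_iUnion, iUnion_spanningSets, Set.inter_univ]
  have hEm : ∀ i, MeasurableSet (E i) := fun i => (hfm _).inter (measurableSet_spanningSets μ _)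
  refine ⟨E, hEm, fun i => ?_, ?_, ?_⟩
  · exact ((measure_mono Set.inter_subset_right).trans_lt (measure_spanningSets_lt_top μ _)).ne
  · obtain ⟨i, hi⟩ : Set.univ ∈ Set.range f := hf ▸ Set.mem_insert _ _
    refine Set.eq_univ_of_univ_subset ?_
    rw [← hi, ← hE i]
    exact Set.iUnion_subset fun n => Set.subset_iUnion E _
  · have hle : MeasurableSpace.generateFrom 𝓢 ≤
        MeasurableSpace.comap (cantorCode.{u} E) inferInstance := by
      refine MeasurableSpace.generateFrom_le fun s hs => ?_
      obtain ⟨i, rfl⟩ : s ∈ Set.range f := hf ▸ Set.mem_insert_of_mem _ hs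
      refine ⟨⋃ n, cantorCylinder (Nat.pair i n),
        MeasurableSet.iUnion fun n => measurableSet_cantorCylinder _, ?_⟩
      rw [Set.preimage_iUnion]
      simp_rw [cantorCode_preimage_cylinder]
      exact hE i
    have hle2 : (MeasurableSpace.generateFrom 𝓢).prod (MeasurableSpace.generateFrom 𝓢) ≤
        MeasurableSpace.comap (Prod.map (cantorCode.{u} E) (cantorCode.{u} E)) inferInstance := by
      refine (MeasurableSpace.prod_self_mono hle).trans (sup_le ?_ ?_)
      · rw [MeasurableSpace.comap_comp]
        exact ((MeasurableSpace.comap_comp (f := Prod.fst)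
          (g := Prod.map (cantorCode.{u} E) (cantorCode.{u} E))).symm.le).trans
            (MeasurableSpace.comap_mono measurable_fst.comap_le)
      · rw [MeasurableSpace.comap_comp]
        exact ((MeasurableSpace.comap_comp (f := Prod.snd)
          (g := Prod.map (cantorCode.{u} E) (cantorCode.{u} E))).symm.le).trans
            (MeasurableSpace.comap_mono measurable_snd.comap_le)
    -- A function measurable for the σ-algebra pulled back by the code factors through the code.
    obtain ⟨V, hV, hgV⟩ := (hgm.mono hle2 le_rfl).exists_eq_measurable_comp
    exact ⟨V, hV, fun x y => congrFun hgV (x, y)⟩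

end CountablyGenerated

/-- Every graphon is a.e. a pull-back of a symmetric measurable kernel on the Cantor space by the
code of countably many sets of finite measure. -/
theorem Graphon.exists_cantorKernel (G : Graphon.{u}) :
    ∃ E : ℕ → Set G.S, (∀ i, MeasurableSet (E i)) ∧ (∀ i, G.μ (E i) ≠ ∞) ∧
      ⋃ i, E i = Set.univ ∧ ∃ V : CantorSpace.{u} → CantorSpace.{u} → ℝ,
        Measurable (fun p : CantorSpace.{u} × CantorSpace.{u} => V p.1 p.2) ∧
        (∀ z w, V z w = V w z) ∧ (∀ z w, ¬ (z ≠ cantorZero ∧ w ≠ cantorZero) → V z w = 0) ∧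
        ∀ᵐ p ∂(G.μ.prod G.μ), G.W p.1 p.2 = V (cantorCode E p.1) (cantorCode E p.2) := by
  classical
  obtain ⟨g, hg, hWg⟩ := G.integrable.aemeasurable
  obtain ⟨E, hE, hEf, hcov, V, hV, hgV⟩ := exists_cantorCode_factorization.{u} G.μ hg
  have hne : ∀ x, cantorCode.{u} E x ≠ cantorZero := by
    intro x hx
    rw [cantorCode_eq_zero_iff, hcov] at hx
    exact hx (Set.mem_univ x)
  -- Symmetrizing changes nothing a.e. because `G.W` is symmetric. Neither does truncation at the
  -- origin, as the `E i` cover the space and no point is coded by the origin.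
  refine ⟨E, hE, hEf, hcov, fun z w => if z ≠ cantorZero ∧ w ≠ cantorZero then
    (V (z, w) + V (w, z)) / 2 else 0, ?_, ?_, ?_, ?_⟩
  · refine Measurable.ite ?_ ((hV.add (hV.comp measurable_swap)).div_const 2) measurable_const
    exact (measurable_fst (measurableSet_singleton _).compl).inter
      (measurable_snd (measurableSet_singleton _).compl)
  · intro z w
    simp only [and_comm, add_comm]
  · intro z w h
    simp only [if_neg h]
  · have hswap : ∀ᵐ p ∂(G.μ.prod G.μ), G.W p.2 p.1 = g (p.2, p.1) :=
      Measure.measurePreserving_swap.quasiMeasurePreserving.ae hWg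
    filter_upwards [hWg, hswap] with p hp hp'
    simp only [hne, ne_eq, not_false_eq_true, and_self, if_true]
    rw [← hgV, ← hgV, ← hp', G.symm p.2 p.1]
    have : g (p.1, p.2) = G.W p.1 p.2 := hp.symm
    rw [this]
    ring

/-! ### Limits of measures on clopen sets -/

section ClopenLimits

theorem sigmaFinite_of_iUnion {X : Type*} [MeasurableSpace X] {μ : Measure X} {D : ℕ → Set X}
    (hD : ∀ i, μ (D i) ≠ ∞) (hcov : μ (⋃ i, D i)ᶜ = 0) : SigmaFinite μ := by
  refine ⟨⟨⟨fun i => D i ∪ (⋃ i, D i)ᶜ, fun _ => trivial, fun i => ?_, ?_⟩⟩⟩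
  · exact (measure_union_ne_top (hD i) (by rw [hcov]; exact ENNReal.zero_ne_top)).lt_top
  · rw [← Set.iUnion_union, Set.union_compl_self]

variable {X : Type*} [TopologicalSpace X] [MeasurableSpace X] [BorelSpace X] [CompactSpace X]
  [T2Space X]

/-- Measures of bounded mass on a compact space are weakly relatively compact, and the indicator of
a clopen set is a continuous test function. -/
theorem exists_tendsto_measure_isClopen (𝒰 : Ultrafilter ℕ) (π : ℕ → Measure X) {c : ℝ≥0∞}
    (hc : c ≠ ∞) (hπ : ∀ n, π n Set.univ ≤ c) : ∃ ρ : Measure X, IsFiniteMeasure ρ ∧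
      ∀ C, IsClopen C → Filter.Tendsto (fun n => π n C) 𝒰 (nhds (ρ C)) := by
  have hfin : ∀ n, IsFiniteMeasure (π n) := fun n => ⟨(hπ n).trans_lt hc.lt_top⟩
  let f : ℕ → FiniteMeasure X := fun n => ⟨π n, hfin n⟩
  have hK := isCompact_setOfPred_finiteMeasure_le_of_compactSpace X c.toNNReal
  have hmass : ∀ n, (f n).mass ≤ c.toNNReal := fun n =>
    ENNReal.toNNReal_mono hc (hπ n)
  obtain ⟨ρ, -, hρ⟩ := hK.ultrafilter_le_nhds (𝒰.map f)
    (Filter.le_principal_iff.2 (Filter.Eventually.of_forall (f := (𝒰 : Filter ℕ)) hmass))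
  have ht : Filter.Tendsto f 𝒰 (nhds ρ) := hρ
  rw [FiniteMeasure.tendsto_iff_forall_integral_tendsto] at ht
  refine ⟨ρ, inferInstance, fun C hC => ?_⟩
  have hcont : Continuous (C.indicator (1 : X → ℝ)) := continuous_one.indicator (by
    rw [hC.frontier_eq]; simp)
  have h1 := ht (BoundedContinuousFunction.mkOfCompact ⟨_, hcont⟩)
  have hCm : MeasurableSet C := hC.isOpen.measurableSet
  have hint : ∀ κ : Measure X, ∫ x, (BoundedContinuousFunction.mkOfCompact
      ⟨C.indicator (1 : X → ℝ), hcont⟩) x ∂κ = (κ C).toReal := by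
    intro κ
    change ∫ x, C.indicator (1 : X → ℝ) x ∂κ = _
    rw [integral_indicator_one hCm]
    rfl
  simp only [hint] at h1
  exact (ENNReal.tendsto_toReal_iff (fun n => measure_ne_top (π n) C) (measure_ne_top _ C)).1 h1

/-- Measures that are bounded on each of countably many clopen sets converge, along an ultrafilter,
on the clopen subsets of the union of these sets. -/
theorem exists_tendsto_measure_isClopen_subset_iUnion (𝒰 : Ultrafilter ℕ) (π : ℕ → Measure X)
    {D : ℕ → Set X} (hD : ∀ i, IsClopen (D i)) {c : ℕ → ℝ≥0∞} (hc : ∀ i, c i ≠ ∞)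
    (hπ : ∀ n i, π n (D i) ≤ c i) : ∃ ρ : Measure X, ρ (⋃ i, D i)ᶜ = 0 ∧
      ∀ C, IsClopen C → C ⊆ ⋃ i, D i →
        ρ C ≠ ∞ ∧ Filter.Tendsto (fun n => π n C) 𝒰 (nhds (ρ C)) := by
  -- The limits are taken separately on disjoint clopen pieces, along the same ultrafilter, and then
  -- summed.
  have hD' : ∀ i, IsClopen (disjointed D i) := fun i =>
    disjointedRec (fun t j ht => ht.diff (hD j)) (hD i)
  have hDm : ∀ i, MeasurableSet (disjointed D i) := fun i => (hD' i).isOpen.measurableSet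
  have hb : ∀ i n, (π n).restrict (disjointed D i) Set.univ ≤ c i := fun i n => by
    rw [Measure.restrict_apply_univ]
    exact (measure_mono (disjointed_subset D i)).trans (hπ n i)
  choose ρ hρfin hρ using fun i => exists_tendsto_measure_isClopen 𝒰 _ (hc i) (hb i)
  have hnull : ∀ i, ρ i (disjointed D i)ᶜ = 0 := by
    intro i
    refine tendsto_nhds_unique (hρ i _ (hD' i).compl) ?_
    simp [Measure.restrict_apply (hDm i).compl]
  refine ⟨Measure.sum ρ, ?_, fun C hC hCD => ?_⟩
  · have hm : MeasurableSet (⋃ i, D i)ᶜ :=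
      (MeasurableSet.iUnion fun i => (hD i).isOpen.measurableSet).compl
    rw [Measure.sum_apply _ hm, ENNReal.tsum_eq_zero]
    refine fun i => measure_mono_null (Set.compl_subset_compl.2 ?_) (hnull i)
    exact (disjointed_subset D i).trans (Set.subset_iUnion D i)
  · have hCm : MeasurableSet C := hC.isOpen.measurableSet
    rw [← iUnion_disjointed] at hCD
    -- By compactness `C` meets only finitely many pieces, so the limit commutes with the sum and no
    -- mass escapes.
    obtain ⟨t, ht⟩ := hC.isClosed.isCompact.elim_finite_subcover _ (fun i => (hD' i).isOpen) hCD
    have hzero : ∀ i ∉ t, ρ i C = 0 := by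
      intro i hi
      refine measure_mono_null (fun x hx => ?_) (hnull i)
      obtain ⟨j, hj, hxj⟩ := Set.mem_iUnion₂.1 (ht hx)
      have hne : j ≠ i := fun h => hi (h ▸ hj)
      exact Set.disjoint_left.1 (disjoint_disjointed D hne) hxj
    have hsum : Measure.sum ρ C = ∑ i ∈ t, ρ i C := by
      rw [Measure.sum_apply _ hCm, tsum_eq_sum hzero]
    have hsum' : ∀ n, π n C = ∑ i ∈ t, (π n).restrict (disjointed D i) C := by
      intro n
      have h1 : C = ⋃ i ∈ t, C ∩ disjointed D i := by
        rw [← Set.inter_iUnion₂, Set.inter_eq_left.2 ht]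
      conv_lhs => rw [h1]
      rw [measure_biUnion_finset]
      · exact Finset.sum_congr rfl fun i _ => (Measure.restrict_apply hCm).symm
      · intro i _ j _ hij
        exact (disjoint_disjointed D hij).mono Set.inter_subset_right Set.inter_subset_right
      · exact fun i _ => hCm.inter (hDm i)
    rw [hsum]
    refine ⟨ENNReal.sum_ne_top.2 fun i _ => measure_ne_top _ _, ?_⟩
    simp_rw [hsum']
    exact tendsto_finsetSum _ fun i _ => hρ i C hC

end ClopenLimits

/-! ### Measures and kernels determined by clopen sets -/

section ClopenGenerators

variable {X : Type*} [TopologicalSpace X] [MeasurableSpace X] [BorelSpace X] [CompactSpace X]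
  [T2Space X] [TotallyDisconnectedSpace X] [SecondCountableTopology X]

theorem generateFrom_isClopen :
    ‹MeasurableSpace X› = MeasurableSpace.generateFrom {C : Set X | IsClopen C} := by
  rw [BorelSpace.measurable_eq (α := X)]
  exact isTopologicalBasis_isClopen.borel_eq_generateFrom

theorem isPiSystem_isClopen {X : Type*} [TopologicalSpace X] :
    IsPiSystem {C : Set X | IsClopen C} :=
  fun _ hs _ ht _ => IsClopen.inter hs ht

theorem isClopen_accumulate {X : Type*} [TopologicalSpace X] {D : ℕ → Set X}
    (hD : ∀ i, IsClopen (D i)) (n : ℕ) : IsClopen (Set.accumulate D n) :=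
  (Set.finite_Iic n).isClopen_biUnion fun i _ => hD i

theorem measure_accumulate_ne_top {X : Type*} [MeasurableSpace X] {μ : Measure X} {D : ℕ → Set X}
    (hD : ∀ i, μ (D i) ≠ ∞) (n : ℕ) : μ (Set.accumulate D n) ≠ ∞ :=
  (measure_biUnion_lt_top (Set.finite_Iic n) fun i _ => (hD i).lt_top).ne

theorem accumulate_subset_iUnion {X : Type*} (D : ℕ → Set X) (n : ℕ) :
    Set.accumulate D n ⊆ ⋃ i, D i :=
  Set.iUnion₂_subset fun i _ => Set.subset_iUnion D i

/-- Two measures that agree on the clopen subsets of a conull countable union of clopen sets of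
finite measure are equal. -/
theorem MeasureTheory.Measure.ext_of_isClopen {μ ν : Measure X} {D : ℕ → Set X}
    (hD : ∀ i, IsClopen (D i)) (hμ : μ (⋃ i, D i)ᶜ = 0) (hν : ν (⋃ i, D i)ᶜ = 0)
    (hfin : ∀ i, μ (D i) ≠ ∞) (h : ∀ C, IsClopen C → C ⊆ ⋃ i, D i → μ C = ν C) : μ = ν := by
  have hr : ∀ n, μ.restrict (D n) = ν.restrict (D n) := by
    intro n
    have : IsFiniteMeasure (μ.restrict (D n)) := ⟨by
      rw [Measure.restrict_apply_univ]
      exact (hfin n).lt_top⟩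
    have hsub : ∀ s : Set X, s ∩ D n ⊆ ⋃ i, D i := fun s =>
      Set.inter_subset_right.trans (Set.subset_iUnion D n)
    refine ext_of_generate_finite _ generateFrom_isClopen isPiSystem_isClopen (fun s hs => ?_) ?_
    · have hs' : MeasurableSet s := hs.isOpen.measurableSet
      rw [Measure.restrict_apply hs', Measure.restrict_apply hs']
      exact h _ (hs.inter (hD n)) (hsub s)
    · rw [Measure.restrict_apply_univ, Measure.restrict_apply_univ]
      exact h _ (hD n) (Set.subset_iUnion D n)
  have h2 := Measure.restrict_iUnion_congr.2 hr
  rwa [Measure.restrict_eq_self_of_ae_mem (compl_compl (⋃ i, D i) ▸ compl_mem_ae_iff.2 hμ),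
    Measure.restrict_eq_self_of_ae_mem (compl_compl (⋃ i, D i) ▸ compl_mem_ae_iff.2 hν)] at h2

/-- Clopen rectangles generate the product σ-algebra and form a π-system. By countable additivity
the integrals of `F` vanish on all measurable subsets of each square of a clopen set `C n`, and
these squares exhaust the product up to a null set. -/
theorem ae_eq_zero_of_setIntegral_clopen_prod {μ : Measure X} [SigmaFinite μ] {D : ℕ → Set X}
    (hD : ∀ i, IsClopen (D i)) (hμ : μ (⋃ i, D i)ᶜ = 0) {F : X × X → ℝ}
    (hF : Integrable F (μ.prod μ))
    (h : ∀ T U, IsClopen T → IsClopen U → T ⊆ ⋃ i, D i → U ⊆ ⋃ i, D i →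
      ∫ p in T ×ˢ U, F p ∂(μ.prod μ) = 0) : F =ᵐ[μ.prod μ] 0 := by
  set C := Set.accumulate D
  have hCc := isClopen_accumulate hD
  have hCC : ∀ n, MeasurableSet (C n ×ˢ C n) := fun n =>
    (hCc n).isOpen.measurableSet.prod (hCc n).isOpen.measurableSet
  have hspan : IsCountablySpanning {C : Set X | IsClopen C} :=
    ⟨fun _ => Set.univ, fun _ => isClopen_univ, Set.iUnion_const _⟩
  have hgen2 : (Prod.instMeasurableSpace : MeasurableSpace (X × X)) =
      MeasurableSpace.generateFrom
        (Set.image2 (· ×ˢ ·) {C : Set X | IsClopen C} {C : Set X | IsClopen C}) := by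
    rw [← generateFrom_prod_eq hspan hspan, ← generateFrom_isClopen]
  have key : ∀ n, ∀ E : Set (X × X), MeasurableSet E →
      ∫ p in E ∩ C n ×ˢ C n, F p ∂(μ.prod μ) = 0 := by
    intro n E hE
    have hsub : ∀ s : Set X, s ∩ C n ⊆ ⋃ i, D i := fun s =>
      Set.inter_subset_right.trans (accumulate_subset_iUnion D n)
    induction E, hE using MeasurableSpace.induction_on_inter hgen2
      (isPiSystem_isClopen.prod isPiSystem_isClopen) with
    | empty => simp
    | basic t ht =>
      obtain ⟨A, hA, B, hB, rfl⟩ := ht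
      rw [Set.prod_inter_prod]
      exact h _ _ (hA.inter (hCc n)) (hB.inter (hCc n)) (hsub A) (hsub B)
    | compl t ht ih =>
      have h1 := integral_inter_add_sdiff (μ := μ.prod μ) (s := C n ×ˢ C n) ht
        hF.integrableOn
      have h2 := h _ _ (hCc n) (hCc n) (accumulate_subset_iUnion D n)
        (accumulate_subset_iUnion D n)
      rw [h2, Set.inter_comm, ih, zero_add, Set.sdiff_eq, Set.inter_comm] at h1
      exact h1
    | iUnion f hf hfm ih =>
      rw [Set.iUnion_inter, integral_iUnion (fun i => (hfm i).inter (hCC n)) _ hF.integrableOn]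
      · simp [ih]
      · exact fun i j hij => (hf hij).mono Set.inter_subset_left Set.inter_subset_left
  have hae : ∀ n, ∀ᵐ p ∂((μ.prod μ).restrict (C n ×ˢ C n)), F p = 0 := by
    intro n
    refine hF.restrict.ae_eq_zero_of_forall_setIntegral_eq_zero fun s hs _ => ?_
    rw [Measure.restrict_restrict hs]
    exact key n s hs
  rw [← ae_restrict_iUnion_iff] at hae
  have h0 := prod_compl_iUnion_square_eq_zero (μ := μ) (Set.monotone_accumulate (s := D))
    (by rwa [Set.iUnion_accumulate])
  rwa [Measure.restrict_eq_self_of_ae_mem (compl_compl (⋃ n, C n ×ˢ C n) ▸ compl_mem_ae_iff.2 h0)]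
    at hae

end ClopenGenerators

theorem abs_setIntegral_sub_setIntegral_le {X : Type*} [MeasurableSpace X] {μ : Measure X}
    {f g : X → ℝ} (hf : Integrable f μ) (hg : Integrable g μ) (s : Set X) {ε : ℝ} (hε : 0 ≤ ε)
    (h : eLpNorm (f - g) 1 μ ≤ ENNReal.ofReal ε) :
    |∫ x in s, f x ∂μ - ∫ x in s, g x ∂μ| ≤ ε := by
  rw [← integral_sub hf.integrableOn hg.integrableOn, ← Real.norm_eq_abs,
    ← ENNReal.ofReal_le_ofReal_iff hε, ofReal_norm]
  refine (enorm_integral_le_lintegral_enorm _).trans ((setLIntegral_le_lintegral s _).trans ?_)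
  rwa [eLpNorm_one_eq_lintegral_enorm] at h

/-! ### Kernels that depend on one marginal -/

section Marginal

theorem support_comp_prodMap_subset {X Y : Type*} {φ : X → Y} {O : Set Y} {F : Y × Y → ℝ}
    (h0 : ∀ p, p ∉ O ×ˢ O → F p = 0) :
    Function.support (fun p : X × X => F (φ p.1, φ p.2)) ⊆ (φ ⁻¹' O) ×ˢ (φ ⁻¹' O) := by
  intro p hp
  by_contra hne
  exact hp (h0 _ hne)

variable {X Y : Type*} [MeasurableSpace X] [MeasurableSpace Y] {φ : X → Y} {O : Set Y}
  {π : Measure X} {ν : Measure Y} [SigmaFinite π]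

/-- The pulled-back kernel vanishes off the square of `φ ⁻¹' O`, so only the restriction of `π`
matters, and its image is `ν`. The measure `π` may have further mass elsewhere. -/
theorem eLpNorm_comp_of_marginal (hφ : MeasurePreserving φ (π.restrict (φ ⁻¹' O)) ν)
    {F : Y × Y → ℝ} (hF : AEStronglyMeasurable F (ν.prod ν)) (h0 : ∀ p, p ∉ O ×ˢ O → F p = 0) :
    eLpNorm (fun p : X × X => F (φ p.1, φ p.2)) 1 (π.prod π) = eLpNorm F 1 (ν.prod ν) := by
  rw [← eLpNorm_restrict_eq_of_support_subset (support_comp_prodMap_subset h0),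
    ← Measure.prod_restrict]
  exact eLpNorm_comp_measurePreserving (f := Prod.map φ φ) hF (hφ.prod hφ)

theorem integrable_comp_of_marginal (hφ : MeasurePreserving φ (π.restrict (φ ⁻¹' O)) ν)
    {F : Y × Y → ℝ} (hF : Integrable F (ν.prod ν)) (h0 : ∀ p, p ∉ O ×ˢ O → F p = 0) :
    Integrable (fun p : X × X => F (φ p.1, φ p.2)) (π.prod π) := by
  rw [← integrableOn_iff_integrable_of_support_subset (support_comp_prodMap_subset h0),
    IntegrableOn, ← Measure.prod_restrict]
  exact (hφ.prod hφ).integrable_comp_of_integrable hF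

end Marginal

section Limit

variable {X Y : Type*} [TopologicalSpace X] [MeasurableSpace X] [BorelSpace X]
  [TopologicalSpace Y] [MeasurableSpace Y] [BorelSpace Y] [CompactSpace Y]
  [T2Space Y] [TotallyDisconnectedSpace Y] [SecondCountableTopology Y]

/-- If `πs n → π` on clopen sets and the marginals of these measures are all equal to `ν`, then the
integrals of kernels that depend only on the marginal converge on products of clopen sets. -/
theorem tendsto_setIntegral_comp_of_marginal {𝒰 : Filter ℕ} {πs : ℕ → Measure X} {π : Measure X}
    [∀ n, SigmaFinite (πs n)] [SigmaFinite π] {ν : Measure Y} [SigmaFinite ν] {O : Set X}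
    {D : ℕ → Set Y} (hD : ∀ i, IsClopen (D i)) (hνD : ∀ i, ν (D i) ≠ ∞)
    (hν0 : ν (⋃ i, D i)ᶜ = 0)
    (hlim : ∀ C, IsClopen C → C ⊆ O → π C ≠ ∞ ∧ (∀ n, πs n C ≠ ∞) ∧
      Filter.Tendsto (fun n => πs n C) 𝒰 (nhds (π C)))
    {φ : X → Y} (hφc : Continuous φ)
    (hφn : ∀ n, MeasurePreserving φ ((πs n).restrict (φ ⁻¹' ⋃ i, D i)) ν)
    (hφ : MeasurePreserving φ (π.restrict (φ ⁻¹' ⋃ i, D i)) ν)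
    {F : Y × Y → ℝ} (hF : Integrable F (ν.prod ν))
    (hF0 : ∀ p, p ∉ (⋃ i, D i) ×ˢ (⋃ i, D i) → F p = 0) {T U : Set X} (hT : IsClopen T)
    (hU : IsClopen U) (hTO : T ⊆ O) (hUO : U ⊆ O) :
    Filter.Tendsto (fun n => ∫ p in T ×ˢ U, F (φ p.1, φ p.2) ∂((πs n).prod (πs n))) 𝒰
      (nhds (∫ p in T ×ˢ U, F (φ p.1, φ p.2) ∂(π.prod π))) := by
  set O' := ⋃ i, D i
  -- The convergence itself is made the class to be shown dense: it is stable under linear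
  -- combinations and holds for rectangles of clopen sets.
  set P : (Y × Y → ℝ) → Prop := fun g => Integrable g (ν.prod ν) ∧ (∀ p, p ∉ O' ×ˢ O' → g p = 0) ∧
    Filter.Tendsto (fun n => ∫ p in T ×ˢ U, g (φ p.1, φ p.2) ∂((πs n).prod (πs n))) 𝒰
      (nhds (∫ p in T ×ˢ U, g (φ p.1, φ p.2) ∂(π.prod π)))
  have hadd : ∀ f g, P f → P g → P (f + g) := by
    rintro f g ⟨hf, hf0, hft⟩ ⟨hg, hg0, hgt⟩
    refine ⟨hf.add hg, fun p hp => by simp [hf0 p hp, hg0 p hp], ?_⟩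
    have hsplit : ∀ (κ : Measure X) [SigmaFinite κ],
        MeasurePreserving φ (κ.restrict (φ ⁻¹' O')) ν →
        ∫ p in T ×ˢ U, (f + g) (φ p.1, φ p.2) ∂(κ.prod κ) =
          ∫ p in T ×ˢ U, f (φ p.1, φ p.2) ∂(κ.prod κ)
            + ∫ p in T ×ˢ U, g (φ p.1, φ p.2) ∂(κ.prod κ) := fun κ _ hκ =>
      integral_add (integrable_comp_of_marginal hκ hf hf0).integrableOn
        (integrable_comp_of_marginal hκ hg hg0).integrableOn
    rw [hsplit π hφ]
    simp_rw [hsplit (πs _) (hφn _)]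
    exact hft.add hgt
  have hsmul : ∀ (a : ℝ) f, P f → P (a • f) := by
    rintro a f ⟨hf, hf0, hft⟩
    refine ⟨hf.smul a, fun p hp => by simp [hf0 p hp], ?_⟩
    simp only [Pi.smul_apply, integral_smul]
    exact hft.const_smul a
  have hCc := isClopen_accumulate hD
  have hrect : ∀ A ∈ {C : Set Y | IsClopen C}, ∀ B ∈ {C : Set Y | IsClopen C}, ∀ n,
      P (((A ∩ Set.accumulate D n) ×ˢ (B ∩ Set.accumulate D n)).indicator 1) := by
    intro A hA B hB n
    have hAc : IsClopen (A ∩ Set.accumulate D n) := IsClopen.inter hA (hCc n)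
    have hBc : IsClopen (B ∩ Set.accumulate D n) := IsClopen.inter hB (hCc n)
    have hAO : A ∩ Set.accumulate D n ⊆ O' :=
      Set.inter_subset_right.trans (accumulate_subset_iUnion D n)
    have hBO : B ∩ Set.accumulate D n ⊆ O' :=
      Set.inter_subset_right.trans (accumulate_subset_iUnion D n)
    have hfin : ∀ A : Set Y, ν (A ∩ Set.accumulate D n) ≠ ∞ := fun A =>
      ((measure_mono Set.inter_subset_right).trans_lt (measure_accumulate_ne_top hνD n).lt_top).ne
    have hm := hAc.isOpen.measurableSet.prod hBc.isOpen.measurableSet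
    refine ⟨?_, fun p hp => Set.indicator_of_notMem (fun h => hp ⟨hAO h.1, hBO h.2⟩) _, ?_⟩
    · refine (integrable_indicator_iff hm).2 (integrableOn_const ?_)
      rw [Measure.prod_prod]
      exact ENNReal.mul_ne_top (hfin A) (hfin B)
    · set A' := A ∩ Set.accumulate D n
      set B' := B ∩ Set.accumulate D n
      -- For a rectangle the integral is a product of measures of two clopen sets, each of which
      -- converges.
      have hval : ∀ (κ : Measure X) [SigmaFinite κ],
          ∫ p in T ×ˢ U, (A' ×ˢ B').indicator (1 : Y × Y → ℝ) (φ p.1, φ p.2) ∂(κ.prod κ) =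
            (κ (φ ⁻¹' A' ∩ T)).toReal * (κ (φ ⁻¹' B' ∩ U)).toReal := by
        intro κ _
        have h1 : (fun p : X × X => (A' ×ˢ B').indicator (1 : Y × Y → ℝ) (φ p.1, φ p.2)) =
            ((φ ⁻¹' A') ×ˢ (φ ⁻¹' B')).indicator 1 := by
          funext p
          rfl
        rw [h1, integral_indicator_one ((hφc.measurable hAc.isOpen.measurableSet).prod
          (hφc.measurable hBc.isOpen.measurableSet)), Measure.real,
          Measure.restrict_apply ((hφc.measurable hAc.isOpen.measurableSet).prod
          (hφc.measurable hBc.isOpen.measurableSet)), Set.prod_inter_prod, Measure.prod_prod,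
          ENNReal.toReal_mul]
      rw [hval π]
      simp_rw [hval (πs _)]
      obtain ⟨h1, h2, h3⟩ := hlim _ ((hAc.preimage hφc).inter hT)
        (Set.inter_subset_right.trans hTO)
      obtain ⟨h1', h2', h3'⟩ := hlim _ ((hBc.preimage hφc).inter hU)
        (Set.inter_subset_right.trans hUO)
      exact ((ENNReal.tendsto_toReal_iff h2 h1).2 h3).mul
        ((ENNReal.tendsto_toReal_iff h2' h1').2 h3')
  rw [Metric.tendsto_nhds]
  intro ε hε
  have hε3 : 0 < ε / 3 := by positivity
  obtain ⟨g, ⟨hg, hg0, hgt⟩, hle⟩ := exists_eLpNorm_sub_le_of_rectangles (μ := ν) (P := P)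
    generateFrom_isClopen isPiSystem_isClopen isClopen_univ
    (fun n => (hCc n).isOpen.measurableSet) Set.monotone_accumulate
    (measure_accumulate_ne_top hνD) (by rwa [Set.iUnion_accumulate]) hadd hsmul
    (fun f hf => hf.1.aestronglyMeasurable) hrect hF (ENNReal.ofReal_pos.2 hε3).ne'
  -- The error is uniform in `n`, because the `L¹` norm of the pull-back of `F - g` is computed on
  -- the common marginal `ν`.
  have hclose : ∀ (κ : Measure X) [SigmaFinite κ],
      MeasurePreserving φ (κ.restrict (φ ⁻¹' O')) ν →
      |∫ p in T ×ˢ U, F (φ p.1, φ p.2) ∂(κ.prod κ)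
        - ∫ p in T ×ˢ U, g (φ p.1, φ p.2) ∂(κ.prod κ)| ≤ ε / 3 := by
    intro κ _ hκ
    refine abs_setIntegral_sub_setIntegral_le (integrable_comp_of_marginal hκ hF hF0)
      (integrable_comp_of_marginal hκ hg hg0) _ hε3.le ?_
    have := eLpNorm_comp_of_marginal hκ (hF.sub hg).aestronglyMeasurable
      (fun p hp => by simp [hF0 p hp, hg0 p hp])
    exact this.le.trans hle
  rw [Metric.tendsto_nhds] at hgt
  filter_upwards [hgt (ε / 3) hε3] with n hn
  have h1 := hclose (πs n) (hφn n)
  have h2 := hclose π hφ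
  rw [Real.dist_eq] at hn ⊢
  rw [abs_le] at h1 h2
  rw [abs_lt] at hn ⊢
  constructor <;> linarith [h1.1, h1.2, h2.1, h2.2, hn.1, hn.2]

end Limit

/-! ### Partial couplings on the square of the Cantor space -/

/-- The clopen sets that exhaust the complement of the origin in the square of the Cantor space. -/
def cantorSquareCylinder (i : ℕ) : Set (CantorSpace.{u} × CantorSpace.{u}) :=
  Prod.fst ⁻¹' cantorCylinder i ∪ Prod.snd ⁻¹' cantorCylinder i

theorem isClopen_cantorSquareCylinder (i : ℕ) : IsClopen (cantorSquareCylinder.{u} i) :=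
  ((isClopen_cantorCylinder i).preimage continuous_fst).union
    ((isClopen_cantorCylinder i).preimage continuous_snd)

theorem iUnion_cantorSquareCylinder :
    ⋃ i, cantorSquareCylinder.{u} i = Prod.fst ⁻¹' {cantorZero}ᶜ ∪ Prod.snd ⁻¹' {cantorZero}ᶜ := by
  simp only [cantorSquareCylinder, Set.iUnion_union_distrib, ← Set.preimage_iUnion,
    iUnion_cantorCylinder]

/-- A measure on the square of the Cantor space, living off the origin, whose marginals off the
origin are `ν₁` and `ν₂`. -/
structure IsPartialCoupling (ν₁ ν₂ : Measure CantorSpace.{u})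
    (π : Measure (CantorSpace.{u} × CantorSpace.{u})) : Prop where
  fst : MeasurePreserving Prod.fst (π.restrict (Prod.fst ⁻¹' {cantorZero}ᶜ)) ν₁
  snd : MeasurePreserving Prod.snd (π.restrict (Prod.snd ⁻¹' {cantorZero}ᶜ)) ν₂
  null : π (⋃ i, cantorSquareCylinder i)ᶜ = 0

namespace IsPartialCoupling

variable {ν₁ ν₂ : Measure CantorSpace.{u}} {π : Measure (CantorSpace.{u} × CantorSpace.{u})}

theorem measure_fst_preimage (h : IsPartialCoupling ν₁ ν₂ π) {A : Set CantorSpace.{u}}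
    (hA : MeasurableSet A) (h0 : A ⊆ {cantorZero}ᶜ) : π (Prod.fst ⁻¹' A) = ν₁ A := by
  rw [← h.fst.measure_preimage hA.nullMeasurableSet, Measure.restrict_apply (measurable_fst hA),
    ← Set.preimage_inter, Set.inter_eq_left.2 h0]

theorem measure_snd_preimage (h : IsPartialCoupling ν₁ ν₂ π) {A : Set CantorSpace.{u}}
    (hA : MeasurableSet A) (h0 : A ⊆ {cantorZero}ᶜ) : π (Prod.snd ⁻¹' A) = ν₂ A := by
  rw [← h.snd.measure_preimage hA.nullMeasurableSet, Measure.restrict_apply (measurable_snd hA),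
    ← Set.preimage_inter, Set.inter_eq_left.2 h0]

/-- The bound depends on the marginals only; this uniformity is the source of compactness. -/
theorem measure_cantorSquareCylinder_le (h : IsPartialCoupling ν₁ ν₂ π) (i : ℕ) :
    π (cantorSquareCylinder i) ≤ ν₁ (cantorCylinder i) + ν₂ (cantorCylinder i) := by
  have hsub : cantorCylinder.{u} i ⊆ {cantorZero}ᶜ := by
    rw [← iUnion_cantorCylinder]
    exact Set.subset_iUnion _ i
  rw [← h.measure_fst_preimage (measurableSet_cantorCylinder i) hsub,
    ← h.measure_snd_preimage (measurableSet_cantorCylinder i) hsub]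
  exact measure_union_le _ _

theorem sigmaFinite (h : IsPartialCoupling ν₁ ν₂ π) (h₁ : ∀ i, ν₁ (cantorCylinder i) ≠ ∞)
    (h₂ : ∀ i, ν₂ (cantorCylinder i) ≠ ∞) : SigmaFinite π :=
  sigmaFinite_of_iUnion (fun i => ((h.measure_cantorSquareCylinder_le i).trans_lt
    (ENNReal.add_lt_top.2 ⟨(h₁ i).lt_top, (h₂ i).lt_top⟩)).ne) h.null

/-- The uniform bounds on the clopen sets `cantorSquareCylinder i` yield a limit. The marginals
survive: a clopen set avoiding the origin has a clopen preimage, whose mass is constant along the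
sequence. -/
theorem exists_limit (𝒰 : Ultrafilter ℕ)
    {πs : ℕ → Measure (CantorSpace.{u} × CantorSpace.{u})}
    (h₁ : ∀ i, ν₁ (cantorCylinder i) ≠ ∞) (h₂ : ∀ i, ν₂ (cantorCylinder i) ≠ ∞)
    (h₁' : ν₁ {cantorZero} = 0) (h₂' : ν₂ {cantorZero} = 0)
    (h : ∀ n, IsPartialCoupling ν₁ ν₂ (πs n)) : ∃ π, IsPartialCoupling ν₁ ν₂ π ∧
      ∀ C, IsClopen C → C ⊆ ⋃ i, cantorSquareCylinder i → π C ≠ ∞ ∧ (∀ n, πs n C ≠ ∞) ∧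
        Filter.Tendsto (fun n => πs n C) 𝒰 (nhds (π C)) := by
  have hb : ∀ i, ν₁ (cantorCylinder i) + ν₂ (cantorCylinder i) ≠ ∞ := fun i =>
    ENNReal.add_ne_top.2 ⟨h₁ i, h₂ i⟩
  obtain ⟨π, hπ0, hπ⟩ := exists_tendsto_measure_isClopen_subset_iUnion 𝒰 πs
    isClopen_cantorSquareCylinder hb fun n i => (h n).measure_cantorSquareCylinder_le i
  have hmarg : ∀ (φ : CantorSpace.{u} × CantorSpace.{u} → CantorSpace.{u}) (hφ : Continuous φ)
      (ν : Measure CantorSpace.{u}) (hν : ∀ i, ν (cantorCylinder i) ≠ ∞)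
      (hν0 : ν {cantorZero} = 0)
      (hsub : φ ⁻¹' {cantorZero}ᶜ ⊆ ⋃ i, cantorSquareCylinder i)
      (hs : ∀ n A, MeasurableSet A → A ⊆ {cantorZero}ᶜ → πs n (φ ⁻¹' A) = ν A),
      MeasurePreserving φ (π.restrict (φ ⁻¹' {cantorZero}ᶜ)) ν := by
    intro φ hφ ν hν hν0 hsub hs
    have hagree : ∀ C, IsClopen C → C ⊆ {cantorZero}ᶜ →
        (π.restrict (φ ⁻¹' {cantorZero}ᶜ)).map φ C = ν C := by
      intro C hC hC0
      have hCm := hC.isOpen.measurableSet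
      rw [Measure.map_apply hφ.measurable hCm, Measure.restrict_apply (hφ.measurable hCm),
        ← Set.preimage_inter, Set.inter_eq_left.2 hC0]
      refine tendsto_nhds_unique (hπ _ (hC.preimage hφ) ((Set.preimage_mono hC0).trans hsub)).2 ?_
      simp_rw [hs _ C hCm hC0]
      exact tendsto_const_nhds
    have hcyl : ∀ i, cantorCylinder.{u} i ⊆ {cantorZero}ᶜ := fun i =>
      iUnion_cantorCylinder ▸ Set.subset_iUnion _ i
    refine ⟨hφ.measurable, Measure.ext_of_isClopen isClopen_cantorCylinder ?_ ?_ ?_ ?_⟩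
    · rw [iUnion_cantorCylinder, compl_compl,
        Measure.map_apply hφ.measurable (measurableSet_singleton _),
        Measure.restrict_apply (hφ.measurable (measurableSet_singleton _)), ← Set.preimage_inter,
        Set.inter_compl_self, Set.preimage_empty, measure_empty]
    · rw [iUnion_cantorCylinder, compl_compl, hν0]
    · intro i
      rw [hagree _ (isClopen_cantorCylinder i) (hcyl i)]
      exact hν i
    · rw [iUnion_cantorCylinder]
      exact hagree
  refine ⟨π, ⟨hmarg _ continuous_fst _ h₁ h₁' ?_ fun n A => (h n).measure_fst_preimage,
    hmarg _ continuous_snd _ h₂ h₂' ?_ fun n A => (h n).measure_snd_preimage, hπ0⟩,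
    fun C hC hC0 => ⟨(hπ C hC hC0).1, fun n => ?_, (hπ C hC hC0).2⟩⟩
  · rw [iUnion_cantorSquareCylinder]
    exact Set.subset_union_left
  · rw [iUnion_cantorSquareCylinder]
    exact Set.subset_union_right
  · obtain ⟨t, ht⟩ := hC.isClosed.isCompact.elim_finite_subcover _
      (fun i => (isClopen_cantorSquareCylinder i).isOpen) hC0
    refine ((measure_mono ht).trans_lt ?_).ne
    exact measure_biUnion_lt_top t.finite_toSet fun i _ =>
      ((h n).measure_cantorSquareCylinder_le i).trans_lt (hb i).lt_top

/-- If the cut norms of `V₁ ∘ fst - V₂ ∘ snd` along partial couplings tend to `0`, then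
`V₁ ∘ fst = V₂ ∘ snd` holds a.e. for some partial coupling. -/
theorem exists_ae_eq {V₁ V₂ : CantorSpace.{u} → CantorSpace.{u} → ℝ} [SigmaFinite ν₁]
    [SigmaFinite ν₂]
    (h₁ : ∀ i, ν₁ (cantorCylinder i) ≠ ∞) (h₂ : ∀ i, ν₂ (cantorCylinder i) ≠ ∞)
    (h₁' : ν₁ {cantorZero} = 0) (h₂' : ν₂ {cantorZero} = 0)
    (hV₁ : Integrable (fun p : CantorSpace.{u} × CantorSpace.{u} => V₁ p.1 p.2) (ν₁.prod ν₁))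
    (hV₂ : Integrable (fun p : CantorSpace.{u} × CantorSpace.{u} => V₂ p.1 p.2) (ν₂.prod ν₂))
    (hV₁0 : ∀ z w, ¬ (z ≠ cantorZero ∧ w ≠ cantorZero) → V₁ z w = 0)
    (hV₂0 : ∀ z w, ¬ (z ≠ cantorZero ∧ w ≠ cantorZero) → V₂ z w = 0)
    (h : ∀ ε : ℝ, 0 < ε → ∃ π, IsPartialCoupling ν₁ ν₂ π ∧
      ∀ T U : Set (CantorSpace.{u} × CantorSpace.{u}), MeasurableSet T → MeasurableSet U →
        |∫ p in T ×ˢ U, (V₁ p.1.1 p.2.1 - V₂ p.1.2 p.2.2) ∂(π.prod π)| ≤ ε) :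
    ∃ π, IsPartialCoupling ν₁ ν₂ π ∧
      Integrable (fun p : (CantorSpace.{u} × CantorSpace.{u}) ×
          (CantorSpace.{u} × CantorSpace.{u}) =>
        V₁ p.1.1 p.2.1) (π.prod π) ∧
      Integrable (fun p : (CantorSpace.{u} × CantorSpace.{u}) ×
          (CantorSpace.{u} × CantorSpace.{u}) =>
        V₂ p.1.2 p.2.2) (π.prod π) ∧
      ∀ᵐ p ∂(π.prod π), V₁ p.1.1 p.2.1 = V₂ p.1.2 p.2.2 := by
  choose πs hπs hcut using fun n : ℕ => h (1 / ((n : ℝ) + 1)) (by positivity)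
  set 𝒰 := Filter.hyperfilter ℕ
  obtain ⟨π, hπ, hlim⟩ := exists_limit 𝒰 h₁ h₂ h₁' h₂' hπs
  have hσs : ∀ n, SigmaFinite (πs n) := fun n => (hπs n).sigmaFinite h₁ h₂
  have hσ := hπ.sigmaFinite h₁ h₂
  have hV₁0' : ∀ p : CantorSpace.{u} × CantorSpace.{u},
      p ∉ ({cantorZero}ᶜ : Set CantorSpace.{u}) ×ˢ {cantorZero}ᶜ → V₁ p.1 p.2 = 0 :=
    fun p hp => hV₁0 _ _ hp
  have hV₂0' : ∀ p : CantorSpace.{u} × CantorSpace.{u},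
      p ∉ ({cantorZero}ᶜ : Set CantorSpace.{u}) ×ˢ {cantorZero}ᶜ → V₂ p.1 p.2 = 0 :=
    fun p hp => hV₂0 _ _ hp
  have hI₁ := fun {κ} (hκ : IsPartialCoupling ν₁ ν₂ κ) (_ : SigmaFinite κ) =>
    integrable_comp_of_marginal hκ.fst hV₁ hV₁0'
  have hI₂ := fun {κ} (hκ : IsPartialCoupling ν₁ ν₂ κ) (_ : SigmaFinite κ) =>
    integrable_comp_of_marginal hκ.snd hV₂ hV₂0'
  refine ⟨π, hπ, hI₁ hπ hσ, hI₂ hπ hσ, ?_⟩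
  have hzero := ae_eq_zero_of_setIntegral_clopen_prod isClopen_cantorSquareCylinder hπ.null
    ((hI₁ hπ hσ).sub (hI₂ hπ hσ)) (fun T U hT hU hTO hUO => ?_)
  · filter_upwards [hzero] with p hp
    exact sub_eq_zero.1 hp
  · rw [← iUnion_cantorCylinder] at hV₁0' hV₂0'
    -- The two kernels are treated separately, since each depends on a single fixed marginal. The
    -- difference of the integrals is at most `1 / (n + 1)` in absolute value along the sequence, so
    -- its limit is `0`.
    have ht₁ := tendsto_setIntegral_comp_of_marginal isClopen_cantorCylinder h₁
      (by rw [iUnion_cantorCylinder, compl_compl, h₁']) hlim continuous_fst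
      (fun n => iUnion_cantorCylinder.{u} ▸ (hπs n).fst) (iUnion_cantorCylinder.{u} ▸ hπ.fst) hV₁
      hV₁0' hT hU hTO hUO
    have ht₂ := tendsto_setIntegral_comp_of_marginal isClopen_cantorCylinder h₂
      (by rw [iUnion_cantorCylinder, compl_compl, h₂']) hlim continuous_snd
      (fun n => iUnion_cantorCylinder.{u} ▸ (hπs n).snd) (iUnion_cantorCylinder.{u} ▸ hπ.snd) hV₂
      hV₂0' hT hU hTO hUO
    have ht := ht₁.sub ht₂
    simp_rw [← integral_sub (hI₁ (hπs _) (hσs _)).integrableOn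
      (hI₂ (hπs _) (hσs _)).integrableOn] at ht
    rw [← integral_sub (hI₁ hπ hσ).integrableOn (hI₂ hπ hσ).integrableOn] at ht
    refine tendsto_nhds_unique ht ?_
    refine squeeze_zero_norm (a := fun n : ℕ => 1 / ((n : ℝ) + 1)) (fun n => ?_) ?_
    · rw [Real.norm_eq_abs]
      exact hcut n T U hT.isOpen.measurableSet hU.isOpen.measurableSet
    · exact tendsto_one_div_add_atTop_nhds_zero_nat.mono_left Nat.hyperfilter_le_atTop

end IsPartialCoupling

/-! ### From `δ_□ = 0` to a chain -/

namespace Graphon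

/-- The images of the sets `E i` code the larger space as well. Points outside the smaller space get
the origin as code, where `V` vanishes, so the same `V` represents the extension by zero. -/
theorem IsTrivialExtension.exists_cantorMap {H G : Graphon.{u}} (h : H.IsTrivialExtension G)
    {E : ℕ → Set G.S} (hE : ∀ i, MeasurableSet (E i)) (hcov : ⋃ i, E i = Set.univ)
    {V : CantorSpace.{u} → CantorSpace.{u} → ℝ}
    (hV0 : ∀ z w, ¬ (z ≠ cantorZero ∧ w ≠ cantorZero) → V z w = 0)
    (hV : ∀ᵐ p ∂(G.μ.prod G.μ), G.W p.1 p.2 = V (cantorCode E p.1) (cantorCode E p.2)) :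
    ∃ ψ : H.S → CantorSpace.{u}, Measurable ψ ∧
      MeasurePreserving ψ (H.μ.restrict (ψ ⁻¹' {cantorZero}ᶜ)) (G.μ.map (cantorCode E)) ∧
      ∀ᵐ p ∂(H.μ.prod H.μ), H.W p.1 p.2 = V (ψ p.1) (ψ p.2) := by
  obtain ⟨ι, hι, hμ, hW, hW'⟩ := h
  set ψ : H.S → CantorSpace.{u} := cantorCode fun i => ι '' E i
  have hψ : Measurable ψ := measurable_cantorCode fun i => hι.measurableSet_image.2 (hE i)
  have hψι : ψ ∘ ι = cantorCode E := by
    funext x i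
    simp [ψ, cantorCode, hι.injective.mem_set_image]
  have hrange : ψ ⁻¹' {cantorZero}ᶜ = Set.range ι := by
    rw [← iUnion_cantorCylinder, Set.preimage_iUnion]
    simp_rw [ψ, cantorCode_preimage_cylinder]
    rw [← Set.image_iUnion, hcov, Set.image_univ]
  have hzero : ∀ x, x ∉ Set.range ι → ψ x = cantorZero := by
    intro x hx
    rw [← hrange] at hx
    simpa using hx
  refine ⟨ψ, hψ, ⟨hψ, ?_⟩, hι.ae_prod_of_comap ?_ ?_⟩
  · rw [hrange, ← hι.map_comap, Measure.map_map hψ hι.measurable, hψι, hμ]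
  · rw [hμ]
    filter_upwards [hV] with p hp
    rw [hW, hp, ← hψι]
    rfl
  · intro x y hxy
    rw [hW' x y hxy, hV0]
    rintro ⟨h1, h2⟩
    exact hxy ⟨not_not.1 fun h => h1 (hzero x h), not_not.1 fun h => h2 (hzero y h)⟩

/-- The coupling is pushed forward by the pair of codes, after dropping the points for which both
codes are the origin; their mass may be infinite, and both kernels vanish there. Measurable sets
pull back to measurable sets, so every integral over a rectangle is one of those in the cut norm of
the original coupling. -/
theorem exists_isPartialCoupling_of_coupling {H₁ H₂ : Graphon.{u}} (c : Coupling H₁.μ H₂.μ)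
    {V₁ V₂ : CantorSpace.{u} → CantorSpace.{u} → ℝ}
    (hV₁ : Measurable fun p : CantorSpace.{u} × CantorSpace.{u} => V₁ p.1 p.2)
    (hV₂ : Measurable fun p : CantorSpace.{u} × CantorSpace.{u} => V₂ p.1 p.2)
    {ψ₁ : H₁.S → CantorSpace.{u}} {ψ₂ : H₂.S → CantorSpace.{u}} {ν₁ ν₂ : Measure CantorSpace.{u}}
    (hψ₁ : Measurable ψ₁) (hψ₂ : Measurable ψ₂)
    (hν₁ : MeasurePreserving ψ₁ (H₁.μ.restrict (ψ₁ ⁻¹' {cantorZero}ᶜ)) ν₁)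
    (hν₂ : MeasurePreserving ψ₂ (H₂.μ.restrict (ψ₂ ⁻¹' {cantorZero}ᶜ)) ν₂)
    (hW₁ : ∀ᵐ p ∂(H₁.μ.prod H₁.μ), H₁.W p.1 p.2 = V₁ (ψ₁ p.1) (ψ₁ p.2))
    (hW₂ : ∀ᵐ p ∂(H₂.μ.prod H₂.μ), H₂.W p.1 p.2 = V₂ (ψ₂ p.1) (ψ₂ p.2)) :
    ∃ π, IsPartialCoupling ν₁ ν₂ π ∧ (SigmaFinite π →
      ∀ T U : Set (CantorSpace.{u} × CantorSpace.{u}), MeasurableSet T → MeasurableSet U →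
        ‖∫ p in T ×ˢ U, (V₁ p.1.1 p.2.1 - V₂ p.1.2 p.2.2) ∂(π.prod π)‖ₑ ≤
          cutNorm c.μ (fun x y => H₁.pullback c.φ₁ x y - H₂.pullback c.φ₂ x y)) := by
  have hφ₁ := c.measurePreserving₁
  have hφ₂ := c.measurePreserving₂
  set Ψ : c.S → CantorSpace.{u} × CantorSpace.{u} := fun x => (ψ₁ (c.φ₁ x), ψ₂ (c.φ₂ x))
  have hΨ : Measurable Ψ := (hψ₁.comp hφ₁.measurable).prodMk (hψ₂.comp hφ₂.measurable)
  set O : Set (CantorSpace.{u} × CantorSpace.{u}) := ⋃ i, cantorSquareCylinder i with hO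
  have hOm : MeasurableSet O :=
    MeasurableSet.iUnion fun i => (isClopen_cantorSquareCylinder i).isOpen.measurableSet
  have hz : MeasurableSet ({cantorZero.{u}}ᶜ : Set CantorSpace.{u}) :=
    (measurableSet_singleton _).compl
  have hMm : MeasurableSet (Ψ ⁻¹' O) := hΨ hOm
  have hmarg : ∀ N : Set (CantorSpace.{u} × CantorSpace.{u}), MeasurableSet N → N ⊆ O →
      ((c.μ.restrict (Ψ ⁻¹' O)).map Ψ).restrict N = (c.μ.restrict (Ψ ⁻¹' N)).map Ψ := by
    intro N hN hNO
    rw [Measure.restrict_map hΨ hN, Measure.restrict_restrict (hΨ hN), ← Set.preimage_inter,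
      Set.inter_eq_left.2 hNO]
  have hO1 : (Prod.fst ⁻¹' {cantorZero}ᶜ : Set (CantorSpace.{u} × CantorSpace.{u})) ⊆ O := by
    rw [hO, iUnion_cantorSquareCylinder]
    exact Set.subset_union_left
  have hO2 : (Prod.snd ⁻¹' {cantorZero}ᶜ : Set (CantorSpace.{u} × CantorSpace.{u})) ⊆ O := by
    rw [hO, iUnion_cantorSquareCylinder]
    exact Set.subset_union_right
  refine ⟨(c.μ.restrict (Ψ ⁻¹' O)).map Ψ, ⟨⟨measurable_fst, ?_⟩, ⟨measurable_snd, ?_⟩, ?_⟩,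
    fun hσ T U hT hU => ?_⟩
  · rw [hmarg _ (measurable_fst hz) hO1, Measure.map_map measurable_fst hΨ]
    exact (hν₁.comp (hφ₁.restrict_preimage (hψ₁ hz))).map_eq
  · rw [hmarg _ (measurable_snd hz) hO2, Measure.map_map measurable_snd hΨ]
    exact (hν₂.comp (hφ₂.restrict_preimage (hψ₂ hz))).map_eq
  · rw [Measure.map_apply hΨ hOm.compl, Measure.restrict_apply (hΨ hOm.compl),
      ← Set.preimage_inter, Set.compl_inter_self, Set.preimage_empty, measure_empty]
  · have hF : Measurable fun p : (CantorSpace.{u} × CantorSpace.{u}) ×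
        (CantorSpace.{u} × CantorSpace.{u}) => V₁ p.1.1 p.2.1 - V₂ p.1.2 p.2.2 :=
      (hV₁.comp ((measurable_fst.comp measurable_fst).prodMk
        (measurable_fst.comp measurable_snd))).sub
        (hV₂.comp ((measurable_snd.comp measurable_fst).prodMk
          (measurable_snd.comp measurable_snd)))
    have hint : ∫ p in T ×ˢ U, (V₁ p.1.1 p.2.1 - V₂ p.1.2 p.2.2)
          ∂(((c.μ.restrict (Ψ ⁻¹' O)).map Ψ).prod ((c.μ.restrict (Ψ ⁻¹' O)).map Ψ)) =
        ∫ p in (Ψ ⁻¹' T ∩ Ψ ⁻¹' O) ×ˢ (Ψ ⁻¹' U ∩ Ψ ⁻¹' O),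
          (H₁.pullback c.φ₁ p.1 p.2 - H₂.pullback c.φ₂ p.1 p.2) ∂(c.μ.prod c.μ) := by
      rw [Measure.map_prod_map _ _ hΨ hΨ, setIntegral_map (hT.prod hU)
        hF.aestronglyMeasurable (hΨ.prodMap hΨ).aemeasurable, Measure.prod_restrict,
        Measure.restrict_restrict ((hΨ.prodMap hΨ) (hT.prod hU))]
      have : Prod.map Ψ Ψ ⁻¹' (T ×ˢ U) ∩ (Ψ ⁻¹' O) ×ˢ (Ψ ⁻¹' O) =
          (Ψ ⁻¹' T ∩ Ψ ⁻¹' O) ×ˢ (Ψ ⁻¹' U ∩ Ψ ⁻¹' O) := by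
        rw [← Set.prod_inter_prod]
        rfl
      rw [this]
      refine integral_congr_ae (ae_restrict_of_ae ?_)
      filter_upwards [(hφ₁.prod hφ₁).quasiMeasurePreserving.ae hW₁,
        (hφ₂.prod hφ₂).quasiMeasurePreserving.ae hW₂] with p hp1 hp2
      exact congrArg₂ (· - ·) hp1.symm hp2.symm
    rw [hint]
    exact le_iSup_of_le _ (le_iSup_of_le _ (le_iSup_of_le ((hΨ hT).inter hMm)
      (le_iSup_of_le ((hΨ hU).inter hMm) le_rfl)))

theorem exists_isTrivialExtension_coupling_of_cutDist_eq_zero {G₁ G₂ : Graphon.{u}}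
    (h : cutDist G₁ G₂ = 0) {ε : ℝ≥0∞} (hε : ε ≠ 0) :
    ∃ H₁ H₂ : Graphon.{u}, H₁.IsTrivialExtension G₁ ∧ H₂.IsTrivialExtension G₂ ∧
      ∃ c : Coupling H₁.μ H₂.μ,
        cutNorm c.μ (fun x y => H₁.pullback c.φ₁ x y - H₂.pullback c.φ₂ x y) < ε := by
  have hlt : cutDist G₁ G₂ < ε := h ▸ pos_iff_ne_zero.2 hε
  unfold cutDist extendDist at hlt
  split_ifs at hlt
  · exact ⟨G₁, G₂, .refl _, .refl _, iInf_lt_iff.1 hlt⟩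
  · simp only [iInf_lt_iff] at hlt
    obtain ⟨H₁, H₂, h₁, h₂, -, hlt⟩ := hlt
    exact ⟨H₁, H₂, h₁, h₂, iInf_lt_iff.1 hlt⟩

theorem ElementarilyEquivalent.symm {G₁ G₂ : Graphon.{u}} (h : ElementarilyEquivalent G₁ G₂) :
    ElementarilyEquivalent G₂ G₁ :=
  h.imp Or.symm Or.symm

/-- A kernel on `Y` that vanishes off the square of `N`, where it is pulled back from a graphon, is
connected to that graphon. -/
theorem reflTransGen_of_measurePreserving_restrict (B : Graphon.{u}) (Q : Graphon.{u})
    {N : Set Q.S} (hN : MeasurableSet N) {φ : Q.S → B.S}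
    (hφ : MeasurePreserving φ (Q.μ.restrict N) B.μ) (hQ : ∀ x y, Q.W x y = B.W (φ x) (φ y))
    (hQ0 : ∀ x y, ¬ (x ∈ N ∧ y ∈ N) → Q.W x y = 0) :
    Relation.ReflTransGen ElementarilyEquivalent B Q := by
  have he : MeasurableEmbedding (Subtype.val : N → Q.S) := MeasurableEmbedding.subtype_coe hN
  have := he.sigmaFinite_comap Q.μ
  have hrange : Set.range (Subtype.val : N → Q.S) = N := Subtype.range_coe
  have hQ0' : ∀ x y, ¬ (x ∈ Set.range (Subtype.val : N → Q.S) ∧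
      y ∈ Set.range (Subtype.val : N → Q.S)) → Q.W x y = 0 := by
    rwa [hrange]
  have hval := he.measurePreserving_comap Q.μ
  rw [hrange] at hval
  -- The restriction of `Q` to `N` is a pull-back of `B`, and `Q` is a trivial extension of it.
  let R : Graphon.{u} :=
    { S := N
      μ := Q.μ.comap Subtype.val
      W := fun x y => Q.W x y
      symm := fun x y => Q.symm x y
      integrable := (he.integrable_prod_comap_iff hQ0').2 Q.integrable }
  have hRB : R.IsPullback B :=
    ⟨φ ∘ Subtype.val, hφ.comp hval, Filter.Eventually.of_forall fun p => hQ _ _⟩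
  have hQR : Q.IsTrivialExtension R := ⟨Subtype.val, he, rfl, fun _ _ => rfl, hQ0'⟩
  have h₁ : ElementarilyEquivalent B R := Or.inl (Or.inr hRB)
  have h₂ : ElementarilyEquivalent R Q := Or.inr (Or.inr hQR)
  exact (Relation.ReflTransGen.single h₁).tail h₂

/-- The chain is `G₁, B₁, R₁, Q₁, Q₂, R₂, B₂, G₂`: `Bᵢ` is the kernel on the Cantor space, `Qᵢ` its
pull-back by a coordinate to the limit partial coupling, and `Rᵢ` the restriction of `Qᵢ` to the
points whose `i`-th coordinate is not the origin. The middle link is the a.e. equality of the two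
kernels. -/
theorem reflTransGen_of_cutDist_eq_zero {G₁ G₂ : Graphon.{u}} (h : cutDist G₁ G₂ = 0) :
    Relation.ReflTransGen ElementarilyEquivalent G₁ G₂ := by
  obtain ⟨E₁, hE₁, hE₁f, hcov₁, V₁, hV₁, hV₁s, hV₁0, hGV₁⟩ := G₁.exists_cantorKernel
  obtain ⟨E₂, hE₂, hE₂f, hcov₂, V₂, hV₂, hV₂s, hV₂0, hGV₂⟩ := G₂.exists_cantorKernel
  -- The image measure is finite on cylinders and has no atom at the origin, because the sets `E i`
  -- have finite measure and cover the space.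
  have hbase : ∀ (G : Graphon.{u}) (E : ℕ → Set G.S), (∀ i, MeasurableSet (E i)) →
      (∀ i, G.μ (E i) ≠ ∞) → ⋃ i, E i = Set.univ →
      ∀ V : CantorSpace.{u} → CantorSpace.{u} → ℝ,
      Measurable (fun p : CantorSpace.{u} × CantorSpace.{u} => V p.1 p.2) →
      (∀ᵐ p ∂(G.μ.prod G.μ), G.W p.1 p.2 = V (cantorCode E p.1) (cantorCode E p.2)) →
      (∀ i, G.μ.map (cantorCode.{u} E) (cantorCylinder i) ≠ ∞) ∧
        G.μ.map (cantorCode.{u} E) {cantorZero} = 0 ∧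
        SigmaFinite (G.μ.map (cantorCode.{u} E)) ∧
        Integrable (fun p : CantorSpace.{u} × CantorSpace.{u} => V p.1 p.2)
          ((G.μ.map (cantorCode.{u} E)).prod (G.μ.map (cantorCode.{u} E))) := by
    intro G E hE hEf hcov V hV hGV
    have hm := measurable_cantorCode.{u} hE
    have h1 : ∀ i, G.μ.map (cantorCode.{u} E) (cantorCylinder i) ≠ ∞ := fun i => by
      rw [Measure.map_apply hm (measurableSet_cantorCylinder i), cantorCode_preimage_cylinder]
      exact hEf i
    have h2 : G.μ.map (cantorCode.{u} E) {cantorZero} = 0 := by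
      rw [Measure.map_apply hm (measurableSet_singleton _)]
      convert measure_empty (μ := G.μ)
      refine Set.eq_empty_of_forall_notMem fun x hx => ?_
      have := (cantorCode_eq_zero_iff E x).1 hx
      rw [hcov] at this
      exact this (Set.mem_univ x)
    have h3 : SigmaFinite (G.μ.map (cantorCode.{u} E)) := sigmaFinite_of_iUnion h1 (by
      rw [iUnion_cantorCylinder, compl_compl, h2])
    have hmp : MeasurePreserving (cantorCode.{u} E) G.μ (G.μ.map (cantorCode E)) := ⟨hm, rfl⟩
    exact ⟨h1, h2, h3, ((hmp.prod hmp).integrable_comp hV.aestronglyMeasurable).1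
      (G.integrable.congr hGV)⟩
  obtain ⟨hf₁, hz₁, hσ₁, hI₁⟩ := hbase G₁ E₁ hE₁ hE₁f hcov₁ V₁ hV₁ hGV₁
  obtain ⟨hf₂, hz₂, hσ₂, hI₂⟩ := hbase G₂ E₂ hE₂ hE₂f hcov₂ V₂ hV₂ hGV₂
  obtain ⟨π, hπ, hπ₁, hπ₂, hae⟩ := IsPartialCoupling.exists_ae_eq hf₁ hf₂ hz₁ hz₂ hI₁ hI₂ hV₁0 hV₂0
    (fun ε hε => by
      obtain ⟨H₁, H₂, hH₁, hH₂, c, hc⟩ := exists_isTrivialExtension_coupling_of_cutDist_eq_zero h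
        (ENNReal.ofReal_pos.2 hε).ne'
      obtain ⟨ψ₁, hψ₁, hψν₁, hψW₁⟩ := hH₁.exists_cantorMap hE₁ hcov₁ hV₁0 hGV₁
      obtain ⟨ψ₂, hψ₂, hψν₂, hψW₂⟩ := hH₂.exists_cantorMap hE₂ hcov₂ hV₂0 hGV₂
      obtain ⟨π, hπ, hcut⟩ := exists_isPartialCoupling_of_coupling c hV₁ hV₂ hψ₁ hψ₂ hψν₁ hψν₂
        hψW₁ hψW₂
      refine ⟨π, hπ, fun T U hT hU => ?_⟩
      have h1 := (hcut (hπ.sigmaFinite hf₁ hf₂) T U hT hU).trans hc.le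
      rwa [← ofReal_norm, ENNReal.ofReal_le_ofReal_iff hε.le, Real.norm_eq_abs] at h1)
  have hσ := hπ.sigmaFinite hf₁ hf₂
  have hz : MeasurableSet ({cantorZero.{u}}ᶜ : Set CantorSpace.{u}) :=
    (measurableSet_singleton _).compl
  let B₁ : Graphon.{u} := ⟨CantorSpace.{u}, G₁.μ.map (cantorCode E₁), V₁, hV₁s, hI₁⟩
  let B₂ : Graphon.{u} := ⟨CantorSpace.{u}, G₂.μ.map (cantorCode E₂), V₂, hV₂s, hI₂⟩
  let Q₁ : Graphon.{u} := ⟨CantorSpace.{u} × CantorSpace.{u}, π, fun p q => V₁ p.1 q.1,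
    fun p q => hV₁s _ _, hπ₁⟩
  let Q₂ : Graphon.{u} := ⟨CantorSpace.{u} × CantorSpace.{u}, π, fun p q => V₂ p.2 q.2,
    fun p q => hV₂s _ _, hπ₂⟩
  have hG₁ : ElementarilyEquivalent G₁ B₁ :=
    Or.inl (Or.inl ⟨cantorCode E₁, ⟨measurable_cantorCode hE₁, rfl⟩, hGV₁⟩)
  have hG₂ : ElementarilyEquivalent B₂ G₂ :=
    Or.inl (Or.inr ⟨cantorCode E₂, ⟨measurable_cantorCode hE₂, rfl⟩, hGV₂⟩)
  have hB₁ : Relation.ReflTransGen ElementarilyEquivalent B₁ Q₁ :=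
    reflTransGen_of_measurePreserving_restrict B₁ Q₁ (measurable_fst hz) hπ.fst
      (fun _ _ => rfl) (fun x y hxy => hV₁0 _ _ hxy)
  have hB₂ : Relation.ReflTransGen ElementarilyEquivalent B₂ Q₂ :=
    reflTransGen_of_measurePreserving_restrict B₂ Q₂ (measurable_snd hz) hπ.snd
      (fun _ _ => rfl) (fun x y hxy => hV₂0 _ _ hxy)
  have hQ : ElementarilyEquivalent Q₁ Q₂ :=
    Or.inl (Or.inl ⟨id, MeasurePreserving.id _, hae⟩)
  have : Std.Symm ElementarilyEquivalent.{u} := ⟨fun _ _ h => h.symm⟩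
  have hB₂' : Relation.ReflTransGen ElementarilyEquivalent Q₂ B₂ := Std.Symm.symm _ _ hB₂
  exact (((Relation.ReflTransGen.single hG₁).trans hB₁).tail hQ).trans (hB₂'.tail hG₂)

theorem exists_chain_of_reflTransGen {α : Type*} {r : α → α → Prop} {a b : α}
    (h : Relation.ReflTransGen r a b) : ∃ (N : ℕ) (V : Fin (N + 1) → α), V 0 = a ∧
      V (Fin.last N) = b ∧ ∀ i : Fin N, r (V i.castSucc) (V i.succ) := by
  induction h with
  | refl => exact ⟨0, fun _ => a, rfl, rfl, fun i => i.elim0⟩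
  | @tail b c _ hbc ih =>
    obtain ⟨N, V, h0, hN, hV⟩ := ih
    refine ⟨N + 1, Fin.snoc (α := fun _ => α) V c, ?_, by simp, fun i => ?_⟩
    · rw [← h0, ← Fin.castSucc_zero, Fin.snoc_castSucc]
    · refine Fin.lastCases ?_ (fun j => ?_) i
      · rw [Fin.snoc_castSucc, Fin.succ_last, Fin.snoc_last, hN]
        exact hbc
      · rw [Fin.snoc_castSucc, Fin.succ_castSucc, Fin.snoc_castSucc]
        exact hV j

end Graphon

theorem theorem5p5 (W W' : Graphon.{u}) :
    List.TFAE
      [ Graphon.Equivalent W W',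
        Graphon.cutDist W W' = 0,
        Graphon.distLOne W W' = 0,
        ∃ (N : ℕ) (V : Fin (N + 1) → Graphon.{u}), V 0 = W ∧ V (Fin.last N) = W' ∧
          ∀ i : Fin N, Graphon.ElementarilyEquivalent (V i.castSucc) (V i.succ) ] := by
  tfae_have 1 ↔ 2 := Iff.rfl
  tfae_have 2 → 4 := fun h =>
    Graphon.exists_chain_of_reflTransGen (Graphon.reflTransGen_of_cutDist_eq_zero h)
  tfae_have 4 → 3 := fun ⟨N, V, h0, hN, h⟩ => Graphon.distLOne_eq_zero_of_chain N V h0 hN h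
  tfae_have 3 → 2 := fun h =>
    le_antisymm ((Graphon.cutDist_le_distLOne W W').trans h.le) zero_le
  tfae_finish
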